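/- \textbf{Setting.} Let $n,d$ be dimensions, $(\Omega,\mathcal A,\mathbb P)$ a probability space, $X\subset\mathbb R^n$, $\Phi:\mathbb R^n\times\mathbb R^d\to\mathbb R^n$ a (jointly) measurable map, $\xi:\Omega\to\mathbb R^d$ a random vector and $F(x)=\mathbb E[\Phi(x,\xi)]$. For a map $G$, $\mathrm{VI}(X,G)$ asks for $s\in X$ with $G(s)^T(x-s)\ge 0$ for all $x\in X$. Norms are Euclidean and $\Pi_X$ is the Euclidean projection onto $X$. For $\epsilon>0$ put $X^\epsilon=X+\{z:\|z\|\le\epsilon\}$. \textbf{Assumption 1.} $X$ is closed, bounded and convex; $F$ is monotone and continuous on $X^\epsilon$; there is $C>0$ with $\mathbb E\|\Phi(x,\xi)\|^2\le C^2$ for all $x\in X^\epsilon$; and $\mathrm{VI}(X,F)$ has a solution. \textbf{Assumption 2.} The random vectors $\xi_j$ ($j\ge0$) are independent copies of $\xi$; the random vectors $z_i$ ($i\ge0$) are independent, $z_i$ being uniformly distributed on $\{z\in\mathbb R^n:\|z\|\le\epsilon_i\}$; $x_0$ is an $X$-valued random vector; and $x_0$, the sequence $(\xi_j)_j$ and the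 sequence $(z_i)_i$ are mutually independent. \textbf{Assumption 3.} (a) $\gamma_k,\eta_k,\epsilon_k$ $(k\ge 0)$ are positive and tend to $0$; (b) there is $K_1\ge0$ with $\frac{\gamma_k}{\eta_k\epsilon_k^2}\le\frac12\Big(\frac{(n-1)!!}{n!!\,\kappa\,C}\Big)^2$ for $k\ge K_1$, where $\kappa=1$ if $n$ is odd and $\kappa=2/\pi$ if $n$ is even; (c) $\epsilon_k\le\epsilon$ for all $k$; (d) $\sum_k\gamma_k\eta_k=\infty$; (e) $\sum_k\gamma_k^2<\infty$; (f) $\sum_{k\ge1}\frac{1}{\eta_{k-1}^2\eta_k\gamma_k}\Big(1-\frac{\min\{\epsilon_k,\epsilon_{k-1}\}}{\max\{\epsilon_k,\epsilon_{k-1}\}}\Big)^2<\infty$; (g) $\sum_{k\ge1}\frac1{\eta_k\gamma_k}\Big(1-\frac{\eta_k}{\eta_{k-1}}\Big)^2<\infty$; (h) $\gamma_k/\eta_k\to0$; (i) $\frac1{\eta_k^2\gamma_k}\Big(1-\frac{\min\{\epsilon_k,\epsilon_{k-1}\}}{\max\{\epsilon_k,\epsilon_{k-1}\}}\Big)\to0$;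 (j) $\frac1{\eta_k\gamma_k}\Big|1-\frac{\eta_k}{\eta_{k-1}}\Big|\to0$. The RSSA scheme is $$x_{k+1}=\Pi_X\big(x_k-\gamma_k(\Phi(x_k+z_k,\xi_k)+\eta_kx_k)\big),\qquad k\ge0,$$ and the smoothed maps are $F_k(x)=\mathbb E[F(x+z_k)]$, $x\in X$. \textbf{Theorem (almost sure convergence of the RSSA scheme).} Let Assumptions 1, 2 and 3 hold. Then for every $k\ge0$ the problem $\mathrm{VI}(X,F_k+\eta_k\mathbf I)$ has a unique solution $s_k$, and $\mathrm{VI}(X,F)$ has a unique solution $t^*$ of least Euclidean norm. Moreover: (a) Almost surely, $\lim_{k\to\infty}\|x_{k+1}-s_k\|=0$ and every accumulation point of $\{x_k\}$ is a solution of $\mathrm{VI}(X,F)$. (b) If $\lim_{k\to\infty}\epsilon_k/\eta_k=0$ and $F$ is differentiable with bounded Jacobian in a neighborhood of $t^*$, then $x_k\to t^*$ almost surely. -/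

import Mathlib

open MeasureTheory ProbabilityTheory Filter Topology
open scoped Pointwise Nat

/-- The Euclidean space `ℝⁿ`. -/
abbrev RSpace (n : ℕ) : Type := EuclideanSpace ℝ (Fin n)

/-- `s` solves the variational inequality `VI(X, G)`:
`s ∈ X` and `G(s)ᵀ(x - s) ≥ 0` for every `x ∈ X`. -/
def IsVISol {n : ℕ} (X : Set (RSpace n)) (G : RSpace n → RSpace n) (s : RSpace n) : Prop :=
  s ∈ X ∧ ∀ x ∈ X, 0 ≤ inner ℝ (G s) (x - s)

/-- `t` is a solution of `VI(X, G)` of least Euclidean norm. -/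
def IsLeastNormVISol {n : ℕ} (X : Set (RSpace n)) (G : RSpace n → RSpace n) (t : RSpace n) :
    Prop :=
  IsVISol X G t ∧ ∀ y, IsVISol X G y → ‖t‖ ≤ ‖y‖

/-- The `ε`-enlargement `X + B(0, ε)` of the set `X`. -/
def enlargement {n : ℕ} (X : Set (RSpace n)) (ε : ℝ) : Set (RSpace n) :=
  X + Metric.closedBall (0 : RSpace n) ε

/-- `p` is a point of `X` nearest to `u`. -/
def IsNearest {n : ℕ} (X : Set (RSpace n)) (u p : RSpace n) : Prop :=
  p ∈ X ∧ ∀ y ∈ X, ‖u - p‖ ≤ ‖u - y‖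

open Classical in
/-- The Euclidean projection `Π_X(u)`. By `existsUnique_isNearest` below it is the unique nearest
point of `X` when `X` is nonempty, closed and convex. -/
noncomputable def euclProj {n : ℕ} (X : Set (RSpace n)) (u : RSpace n) : RSpace n :=
  if h : ∃ p, IsNearest X u p then h.choose else u

/-- Nearest points in a nonempty closed convex set exist and are unique. -/
theorem existsUnique_isNearest {n : ℕ} {X : Set (RSpace n)} (hne : X.Nonempty)
    (hcl : IsClosed X) (hconv : Convex ℝ X) (u : RSpace n) : ∃! p, IsNearest X u p := by
  obtain ⟨p, hp, hmin⟩ := exists_norm_eq_iInf_of_complete_convex hne hcl.isComplete hconv u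
  have hbdd : BddBelow (Set.range fun w : X => ‖u - w‖) :=
    ⟨0, by rintro _ ⟨w, rfl⟩; exact norm_nonneg _⟩
  have hpn : IsNearest X u p := ⟨hp, fun y hy => hmin ▸ ciInf_le hbdd (⟨y, hy⟩ : X)⟩
  refine ⟨p, hpn, fun q hq => ?_⟩
  have h1 := (norm_eq_iInf_iff_real_inner_le_zero hconv hp).1 hmin q hq.1
  have h2 : ‖u - q‖ ≤ ‖u - p‖ := hq.2 p hp
  have h3 : ‖u - q‖ ^ 2 = ‖u - p‖ ^ 2 - 2 * inner ℝ (u - p) (q - p) + ‖q - p‖ ^ 2 := by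
    rw [← norm_sub_sq_real]; congr 2; abel
  have h4 : ‖u - q‖ ^ 2 ≤ ‖u - p‖ ^ 2 := by gcongr
  have h5 : ‖q - p‖ ^ 2 ≤ 0 := by linarith
  have h6 : ‖q - p‖ = 0 := by nlinarith [norm_nonneg (q - p)]
  exact sub_eq_zero.1 (norm_eq_zero.1 h6)

/-- The defining property of the projection onto a nonempty closed convex set. -/
theorem euclProj_isNearest {n : ℕ} {X : Set (RSpace n)} (hne : X.Nonempty)
    (hcl : IsClosed X) (hconv : Convex ℝ X) (u : RSpace n) : IsNearest X u (euclProj X u) := by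
  have h := (existsUnique_isNearest hne hcl hconv u).exists
  rw [euclProj, dif_pos h]
  exact h.choose_spec

/-- The expected-value mapping `F(x) = 𝔼[Φ(x, ξ)]`. -/
noncomputable def meanMap {n d : ℕ} {Ω : Type*} [MeasurableSpace Ω] (P : Measure Ω)
    (Φ : RSpace n → RSpace d → RSpace n) (ξ : Ω → RSpace d) (x : RSpace n) : RSpace n :=
  ∫ ω, Φ x (ξ ω) ∂P

/-- The smoothed mapping `x ↦ 𝔼[G(x + z)]` for a random vector `z`. -/
noncomputable def smoothedMap {n : ℕ} {Ω : Type*} [MeasurableSpace Ω] (P : Measure Ω)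
    (G : RSpace n → RSpace n) (z : Ω → RSpace n) (x : RSpace n) : RSpace n :=
  ∫ ω, G (x + z ω) ∂P

/-- The regularized mapping `G + η I`. -/
def regularizedMap {n : ℕ} (G : RSpace n → RSpace n) (η : ℝ) (x : RSpace n) : RSpace n :=
  G x + η • x

/-- The regularized smoothed stochastic approximation scheme
`x_{k+1} = Π_X(x_k - γ_k (Φ(x_k + z_k, ξ_k) + η_k x_k))`. -/
noncomputable def rssa {n d : ℕ} {Ω : Type*} (X : Set (RSpace n))
    (Φ : RSpace n → RSpace d → RSpace n) (γ η : ℕ → ℝ) (x0 : Ω → RSpace n)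
    (ξs : ℕ → Ω → RSpace d) (z : ℕ → Ω → RSpace n) : ℕ → Ω → RSpace n
  | 0, ω => x0 ω
  | k + 1, ω =>
    euclProj X (rssa X Φ γ η x0 ξs z k ω -
      γ k • (Φ (rssa X Φ γ η x0 ξs z k ω + z k ω) (ξs k ω) + η k • rssa X Φ γ η x0 ξs z k ω))

/-- Assumptions on the problem data: the set `X`, the sampled mapping `Φ`, the random
vector `ξ`, the enlargement radius `ε` and the second-moment constant `C`. -/
structure ProblemAssumption {n d : ℕ} {Ω : Type*} [MeasurableSpace Ω] (P : Measure Ω)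
    (X : Set (RSpace n)) (Φ : RSpace n → RSpace d → RSpace n) (ξ : Ω → RSpace d)
    (ε C : ℝ) : Prop where
  closed : IsClosed X
  bounded : Bornology.IsBounded X
  convex : Convex ℝ X
  measurable_Φ : Measurable (Function.uncurry Φ)
  measurable_ξ : Measurable ξ
  /-- `F` is monotone on the enlargement of `X`. -/
  monotone : ∀ x ∈ enlargement X ε, ∀ y ∈ enlargement X ε,
    0 ≤ inner ℝ (meanMap P Φ ξ x - meanMap P Φ ξ y) (x - y)
  /-- `F` is continuous on the enlargement of `X`. -/
  continuous : ContinuousOn (meanMap P Φ ξ) (enlargement X ε)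
  C_pos : 0 < C
  /-- `𝔼 ‖Φ(x, ξ)‖² ≤ C²` on the enlargement of `X` (with finiteness made explicit). -/
  second_moment : ∀ x ∈ enlargement X ε,
    Integrable (fun ω => ‖Φ x (ξ ω)‖ ^ 2) P ∧ ∫ ω, ‖Φ x (ξ ω)‖ ^ 2 ∂P ≤ C ^ 2
  /-- `VI(X, F)` is solvable. -/
  solvable : ∃ x, IsVISol X (meanMap P Φ ξ) x

/-- Assumptions on the random inputs of the scheme: the samples `ξs j`, which are i.i.d. copies
of `ξ`; the perturbations `z i`, independent and uniform on the balls of radius `ε_i`; and the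
initial point. The sample sequence, the perturbation sequence and `x0` are jointly independent. -/
structure RandomInputAssumption {n d : ℕ} {Ω : Type*} [MeasurableSpace Ω] (P : Measure Ω)
    (X : Set (RSpace n)) (ξ : Ω → RSpace d) (εs : ℕ → ℝ) (x0 : Ω → RSpace n)
    (ξs : ℕ → Ω → RSpace d) (z : ℕ → Ω → RSpace n) : Prop where
  measurable_x0 : Measurable x0
  x0_mem : ∀ ω, x0 ω ∈ X
  measurable_ξs : ∀ j, Measurable (ξs j)
  measurable_z : ∀ i, Measurable (z i)
  identDistrib_ξs : ∀ j, IdentDistrib (ξs j) ξ P P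
  indep_ξs : iIndepFun ξs P
  uniform_z : ∀ i, pdf.IsUniform (z i) (Metric.closedBall (0 : RSpace n) (εs i)) P volume
  indep_z : iIndepFun z P
  indep_ξs_z : IndepFun (fun ω j => ξs j ω) (fun ω i => z i ω) P
  indep_x0 : IndepFun x0 (fun ω => ((fun j => ξs j ω), (fun i => z i ω))) P

/-- The constant `κ`: it is `1` in odd dimension and `2 / π` in even dimension. -/
noncomputable def kappa (n : ℕ) : ℝ := if Odd n then 1 else 2 / Real.pi

/-- `1 - min(ε_k, ε_{k-1}) / max(ε_k, ε_{k-1})`, written at the index `k + 1`. -/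
noncomputable def smoothingGap (εs : ℕ → ℝ) (k : ℕ) : ℝ :=
  1 - min (εs (k + 1)) (εs k) / max (εs (k + 1)) (εs k)

/-- Assumptions (a)-(j) on the steplength, regularization and smoothing sequences. Conditions
involving the indices `k` and `k - 1` are written at `k + 1` and `k`. -/
structure TuningAssumption (n : ℕ) (ε C : ℝ) (γ η εs : ℕ → ℝ) : Prop where
  γ_pos : ∀ k, 0 < γ k
  η_pos : ∀ k, 0 < η k
  εs_pos : ∀ k, 0 < εs k
  γ_lim : Tendsto γ atTop (𝓝 0)
  η_lim : Tendsto η atTop (𝓝 0)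
  εs_lim : Tendsto εs atTop (𝓝 0)
  cond_b : ∃ K₁ : ℕ, ∀ k ≥ K₁,
    γ k / (η k * εs k ^ 2) ≤ 0.5 * (((n - 1)‼ : ℝ) / ((n‼ : ℝ) * kappa n * C)) ^ 2
  cond_c : ∀ k, εs k ≤ ε
  cond_d : Tendsto (fun N => ∑ k ∈ Finset.range N, γ k * η k) atTop atTop
  cond_e : Summable fun k => γ k ^ 2
  cond_f : Summable fun k =>
    1 / (η k ^ 2 * η (k + 1) * γ (k + 1)) * smoothingGap εs k ^ 2
  cond_g : Summable fun k =>
    1 / (η (k + 1) * γ (k + 1)) * (1 - η (k + 1) / η k) ^ 2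
  cond_h : Tendsto (fun k => γ k / η k) atTop (𝓝 0)
  cond_i : Tendsto (fun k =>
    1 / (η (k + 1) ^ 2 * γ (k + 1)) * smoothingGap εs k) atTop (𝓝 0)
  cond_j : Tendsto (fun k =>
    1 / (η (k + 1) * γ (k + 1)) * |1 - η (k + 1) / η k|) atTop (𝓝 0)

/-- `G` is differentiable with bounded Jacobian in a neighborhood of `t`. -/
def BoundedJacobianNear {n : ℕ} (G : RSpace n → RSpace n) (t : RSpace n) : Prop :=
  ∃ ρ > 0, ∃ J : ℝ, ∀ x ∈ Metric.ball t ρ, DifferentiableAt ℝ G x ∧ ‖fderiv ℝ G x‖ ≤ J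

/-! ### Euclidean projection onto a closed convex set. -/

section Projection

variable {n : ℕ} {X : Set (RSpace n)}

/-! The iterates are compared with the deterministic solutions `s k` of the regularized smoothed
problems. Given the past, the projection being nonexpansive and `F_k + η_k I` being `η_k`-strongly
monotone, one step multiplies the mean squared distance to `s k` by `1 - 2 γ_k η_k`, up to an error
`O(γ_k²)` controlled by the second moment (`integral_norm_rssaStep_sub_sq_le`).

The target moves, but slowly. `F_k` is the average of `F` over a ball of radius `ε_k`, and changing
the radius changes the average by at most `2 C n (1 - min / max)`; strong monotonicity turns this
into a bound on `s (k+1) - s k` (`norm_isVISol_sub_le`). Young's inequality absorbs the drift at the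
price of half the contraction (`one_sub_two_mul_sq_le`). Hence `‖x_{k+1} - s_k‖²` is a bounded
almost-supermartingale with summable errors, which converges almost surely; since `∑ γ_k η_k = ∞`,
its limit is zero (`ae_tendsto_zero_of_setIntegral_le`).

What remains is deterministic. Cluster points of `s` solve `VI(X, F)` by Minty's lemma, and those of
the iterates are among them. If `‖F_k(t*) - F(t*)‖ / η_k → 0`, as in (b) by the mean value
inequality, each cluster point has norm at most `‖t*‖`, so `s k → t*` (`tendsto_isLeastNormVISol`).
-/

theorem euclProj_mem (hne : X.Nonempty) (hcl : IsClosed X) (hconv : Convex ℝ X) (u : RSpace n) :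
    euclProj X u ∈ X :=
  (euclProj_isNearest hne hcl hconv u).1

/-- The variational characterization of the projection. -/
theorem inner_sub_euclProj_nonpos (hne : X.Nonempty) (hcl : IsClosed X) (hconv : Convex ℝ X)
    (u : RSpace n) {y : RSpace n} (hy : y ∈ X) :
    inner ℝ (u - euclProj X u) (y - euclProj X u) ≤ 0 := by
  obtain ⟨hp, hmin⟩ := euclProj_isNearest hne hcl hconv u
  have : Nonempty X := hne.to_subtype
  have hbdd : BddBelow (Set.range fun w : X => ‖u - w‖) :=
    ⟨0, by rintro _ ⟨w, rfl⟩; exact norm_nonneg _⟩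
  refine (norm_eq_iInf_iff_real_inner_le_zero hconv hp).1 (le_antisymm ?_ ?_) y hy
  · exact le_ciInf fun w => hmin w w.2
  · exact ciInf_le hbdd (⟨_, hp⟩ : X)

/-- Adding the variational inequalities of the two projections gives `‖p - q‖² ≤ ⟪u - v, p - q⟫`;
Cauchy–Schwarz does the rest. -/
theorem norm_euclProj_sub_le (hne : X.Nonempty) (hcl : IsClosed X) (hconv : Convex ℝ X)
    (u v : RSpace n) : ‖euclProj X u - euclProj X v‖ ≤ ‖u - v‖ := by
  have h1 := inner_sub_euclProj_nonpos hne hcl hconv u (euclProj_mem hne hcl hconv v)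
  have h2 := inner_sub_euclProj_nonpos hne hcl hconv v (euclProj_mem hne hcl hconv u)
  set p := euclProj X u
  set q := euclProj X v
  have h3 : ‖p - q‖ ^ 2 = inner ℝ (u - v) (p - q) + inner ℝ (u - p) (q - p)
      + inner ℝ (v - q) (p - q) := by
    rw [← real_inner_self_eq_norm_sq]
    simp only [inner_sub_left, inner_sub_right]
    ring
  have h4 := real_inner_le_norm (u - v) (p - q)
  by_contra! h
  nlinarith [norm_nonneg (u - v), norm_nonneg (p - q)]

theorem euclProj_eq_self (hne : X.Nonempty) (hcl : IsClosed X) (hconv : Convex ℝ X)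
    {s : RSpace n} (hs : s ∈ X) : euclProj X s = s := by
  have h := (euclProj_isNearest hne hcl hconv s).2 s hs
  rw [sub_self, norm_zero] at h
  exact (sub_eq_zero.1 (norm_le_zero_iff.1 h)).symm

theorem continuous_euclProj (hne : X.Nonempty) (hcl : IsClosed X) (hconv : Convex ℝ X) :
    Continuous (euclProj X) :=
  (LipschitzWith.of_dist_le_mul (K := 1) fun u v => by
    simpa [dist_eq_norm] using norm_euclProj_sub_le hne hcl hconv u v).continuous

theorem isVISol_of_euclProj_eq (hne : X.Nonempty) (hcl : IsClosed X) (hconv : Convex ℝ X)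
    {G : RSpace n → RSpace n} {τ : ℝ} (hτ : 0 < τ) {s : RSpace n}
    (hs : euclProj X (s - τ • G s) = s) : IsVISol X G s := by
  refine ⟨hs ▸ euclProj_mem hne hcl hconv _, fun x hx => ?_⟩
  have h := inner_sub_euclProj_nonpos hne hcl hconv (s - τ • G s) hx
  rw [hs, sub_sub_cancel_left, inner_neg_left, real_inner_smul_left] at h
  exact nonneg_of_mul_nonneg_right (by linarith) hτ

end Projection

/-! ### Monotone variational inequalities: existence, Minty's lemma, stability, least-norm
selection. -/

section VariationalInequality

variable {n : ℕ} {X : Set (RSpace n)} {G : RSpace n → RSpace n}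

theorem IsVISol.eq_of_stronglyMonotone {c : ℝ} (hc : 0 < c)
    (hG : ∀ x ∈ X, ∀ y ∈ X, c * ‖x - y‖ ^ 2 ≤ inner ℝ (G x - G y) (x - y)) {s t : RSpace n}
    (hs : IsVISol X G s) (ht : IsVISol X G t) : s = t := by
  have h1 := hs.2 t ht.1
  have h2 := ht.2 s hs.1
  have h3 := hG s hs.1 t ht.1
  rw [← neg_sub s t, inner_neg_right] at h1
  rw [inner_sub_left] at h3
  have h4 : ‖s - t‖ ^ 2 ≤ 0 := by nlinarith
  exact sub_eq_zero.1 (norm_eq_zero.1 (pow_eq_zero_iff two_ne_zero |>.1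
    (le_antisymm h4 (sq_nonneg _))))

/-- A strongly monotone and Lipschitz variational inequality over a closed convex set is
solvable. -/
theorem exists_isVISol_of_stronglyMonotone (hne : X.Nonempty) (hcl : IsClosed X)
    (hconv : Convex ℝ X) {c L : ℝ} (hc : 0 < c)
    (hG : ∀ x ∈ X, ∀ y ∈ X, c * ‖x - y‖ ^ 2 ≤ inner ℝ (G x - G y) (x - y))
    (hL : ∀ x ∈ X, ∀ y ∈ X, ‖G x - G y‖ ≤ L * ‖x - y‖) : ∃ s, IsVISol X G s := by
  set M := max L c
  have hM : 0 < M := lt_max_of_lt_right hc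
  have hcM : c ≤ M := le_max_right _ _
  -- This step minimizes `1 - 2 τ c + τ² M²`, the squared contraction factor; the minimum is `q`,
  -- nonnegative because `c ≤ M`.
  set τ := c / M ^ 2
  have hτ : 0 < τ := by positivity
  set q := 1 - c ^ 2 / M ^ 2
  have hq0 : 0 ≤ q := sub_nonneg.2 ((div_le_one (by positivity)).2 (by gcongr))
  have hq1 : q < 1 := sub_lt_self _ (by positivity)
  let f : X → X := fun x => ⟨euclProj X (x - τ • G x), euclProj_mem hne hcl hconv _⟩
  have hf : ContractingWith (√q).toNNReal f := by
    refine ⟨?_, LipschitzWith.of_dist_le_mul fun x y => ?_⟩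
    · rw [← NNReal.coe_lt_coe, Real.coe_toNNReal _ (Real.sqrt_nonneg q)]
      exact (Real.sqrt_lt' one_pos).2 (by simpa using hq1)
    · have h1 := norm_euclProj_sub_le hne hcl hconv (x - τ • G x) (y - τ • G y)
      have h2 := hG x x.2 y y.2
      have h3 : ‖G x - G y‖ ≤ M * ‖(x : RSpace n) - y‖ := (hL x x.2 y y.2).trans (by
        gcongr; exact le_max_left _ _)
      have h4 : ‖((x : RSpace n) - τ • G x) - (y - τ • G y)‖ ^ 2 ≤
          q * ‖(x : RSpace n) - y‖ ^ 2 := by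
        have e : ((x : RSpace n) - τ • G x) - (y - τ • G y) =
            ((x : RSpace n) - y) - τ • (G x - G y) := by
          rw [smul_sub]; abel
        rw [e, norm_sub_sq_real, norm_smul, Real.norm_of_nonneg hτ.le, real_inner_smul_right,
          real_inner_comm]
        have h5 : (τ * ‖G x - G y‖) ^ 2 ≤ (τ * (M * ‖(x : RSpace n) - y‖)) ^ 2 := by gcongr
        have h6 : (τ * (M * ‖(x : RSpace n) - y‖)) ^ 2 = c ^ 2 / M ^ 2 * ‖(x : RSpace n) - y‖ ^ 2 := by
          simp only [τ]; field_simp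
        have h7 : τ * (c * ‖(x : RSpace n) - y‖ ^ 2) = c ^ 2 / M ^ 2 * ‖(x : RSpace n) - y‖ ^ 2 := by
          simp only [τ]; field_simp
        have h8 := mul_le_mul_of_nonneg_left h2 hτ.le
        simp only [q]
        linarith
      rw [Subtype.dist_eq, Subtype.dist_eq, dist_eq_norm, dist_eq_norm]
      refine h1.trans ?_
      refine abs_le_of_sq_le_sq' ?_ (by positivity) |>.2
      rw [mul_pow, Real.coe_toNNReal _ (Real.sqrt_nonneg q), Real.sq_sqrt hq0]
      exact h4
  have : CompleteSpace X := hcl.completeSpace_coe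
  have : Nonempty X := hne.to_subtype
  refine ⟨(ContractingWith.fixedPoint f hf : X), isVISol_of_euclProj_eq hne hcl hconv hτ ?_⟩
  exact congrArg Subtype.val hf.fixedPoint_isFixedPt

/-- Minty's lemma. -/
theorem isVISol_iff_minty (hconv : Convex ℝ X)
    (hG : ∀ x ∈ X, ∀ y ∈ X, 0 ≤ inner ℝ (G x - G y) (x - y)) (hcont : ContinuousOn G X)
    {s : RSpace n} : IsVISol X G s ↔ s ∈ X ∧ ∀ x ∈ X, 0 ≤ inner ℝ (G x) (x - s) := by
  refine ⟨fun h => ⟨h.1, fun x hx => ?_⟩, fun h => ⟨h.1, fun x hx => ?_⟩⟩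
  · have h1 := hG x hx s h.1
    have h2 := h.2 x hx
    rw [inner_sub_left] at h1
    linarith
  -- The inequality is tested at points of the segment from `s` to `x`, divided by `t`, and
  -- continuity is used as `t → 0⁺`.
  · have hmem : ∀ t ∈ Set.Icc (0 : ℝ) 1, s + t • (x - s) ∈ X := fun t ht =>
      hconv.add_smul_sub_mem h.1 hx ht
    have hc : ContinuousOn (fun t : ℝ => inner ℝ (G (s + t • (x - s))) (x - s))
        (Set.Icc 0 1) :=
      ContinuousOn.inner (𝕜 := ℝ)
        (hcont.comp (t := X) (by fun_prop) hmem) continuousOn_const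
    have ht := (hc 0 (by simp)).mono_left (nhdsWithin_mono 0 Set.Ioc_subset_Icc_self)
    simp only [zero_smul, add_zero] at ht
    rw [nhdsWithin_Ioc_eq_nhdsGT one_pos] at ht
    refine ge_of_tendsto ht ?_
    filter_upwards [Ioc_mem_nhdsGT one_pos] with t ht
    have h1 := h.2 _ (hmem t ⟨ht.1.le, ht.2⟩)
    rw [add_sub_cancel_left, real_inner_smul_right] at h1
    exact nonneg_of_mul_nonneg_right h1 ht.1

theorem isLeastNormVISol_iff_isNearest {t : RSpace n} :
    IsLeastNormVISol X G t ↔ IsNearest {s | IsVISol X G s} 0 t := by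
  simp [IsLeastNormVISol, IsNearest]

/-- By Minty's lemma the solution set is an intersection of `X` with half-spaces, hence closed and
convex; the least-norm solution is its point nearest to `0`. -/
theorem existsUnique_isLeastNormVISol (hcl : IsClosed X) (hconv : Convex ℝ X)
    (hG : ∀ x ∈ X, ∀ y ∈ X, 0 ≤ inner ℝ (G x - G y) (x - y)) (hcont : ContinuousOn G X)
    (hsol : ∃ x, IsVISol X G x) : ∃! t, IsLeastNormVISol X G t := by
  simp_rw [isLeastNormVISol_iff_isNearest]
  have e : {s | IsVISol X G s} = X ∩ ⋂ x ∈ X, {s | 0 ≤ inner ℝ (G x) (x - s)} := by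
    ext s
    simp [isVISol_iff_minty hconv hG hcont]
  refine existsUnique_isNearest (X := {s | IsVISol X G s}) hsol ?_ ?_ 0
  · rw [e]
    exact hcl.inter (isClosed_biInter fun x _ => isClosed_le continuous_const (by fun_prop))
  · rw [e]
    refine hconv.inter (convex_iInter₂ fun x _ => ?_)
    have : {s | 0 ≤ inner ℝ (G x) (x - s)} = {s | innerSL ℝ (G x) s ≤ inner ℝ (G x) x} := by
      ext s; simp [inner_sub_right]
    rw [this]
    exact convex_halfSpace_le (innerSL ℝ (G x)).isLinear _

/-- Limits of approximate solutions in the sense of Minty are solutions. -/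
theorem isVISol_of_mapClusterPt (hcl : IsClosed X) (hconv : Convex ℝ X)
    (hG : ∀ x ∈ X, ∀ y ∈ X, 0 ≤ inner ℝ (G x - G y) (x - y)) (hcont : ContinuousOn G X)
    {H : ℕ → RSpace n → RSpace n} (hH : ∀ y ∈ X, Tendsto (fun k => H k y) atTop (𝓝 (G y)))
    {s : ℕ → RSpace n} (hs : ∀ k, s k ∈ X) (hsH : ∀ k, ∀ y ∈ X, 0 ≤ inner ℝ (H k y) (y - s k))
    {p : RSpace n} (hp : MapClusterPt p atTop s) : IsVISol X G p := by
  obtain ⟨ψ, hψ, hlim⟩ := hp.tendsto_subseq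
  rw [isVISol_iff_minty hconv hG hcont]
  refine ⟨hcl.mem_of_tendsto hlim (Eventually.of_forall fun k => hs _), fun y hy => ?_⟩
  have h1 := ((hH y hy).comp hψ.tendsto_atTop).inner (𝕜 := ℝ) (tendsto_const_nhds (x := y) |>.sub hlim)
  exact ge_of_tendsto h1 (Eventually.of_forall fun k => hsH _ y hy)

/-- Solutions of two regularized problems with a common modulus of comparison. -/
theorem norm_isVISol_sub_le {H₁ H₂ : RSpace n → RSpace n} {η₁ η₂ δ M : ℝ} (hη : 0 < η₁)
    (hmono : ∀ x ∈ X, ∀ y ∈ X, 0 ≤ inner ℝ (H₁ x - H₁ y) (x - y))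
    (hδ : ∀ x ∈ X, ‖H₂ x - H₁ x‖ ≤ δ) (hM : ∀ x ∈ X, ‖x‖ ≤ M) {s₁ s₂ : RSpace n}
    (h₁ : IsVISol X (regularizedMap H₁ η₁) s₁) (h₂ : IsVISol X (regularizedMap H₂ η₂) s₂) :
    ‖s₂ - s₁‖ ≤ δ / η₁ + M * |1 - η₂ / η₁| := by
  have a1 := h₁.2 s₂ h₂.1
  have a2 := h₂.2 s₁ h₁.1
  have a3 := hmono s₂ h₂.1 s₁ h₁.1
  simp only [regularizedMap] at a1 a2
  set u := s₂ - s₁ with hu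
  have hu' : s₁ - s₂ = -u := by simp [hu]
  -- Each inequality is tested at the other solution. Their sum leaves only the differences `H₁ -
  -- H₂` and `η₁ - η₂`, both evaluated at `s₂`.
  have e : η₁ * ‖u‖ ^ 2 + inner ℝ (H₁ s₂ - H₁ s₁) u = inner ℝ (H₁ s₂ - H₂ s₂) u
      + inner ℝ ((η₁ - η₂) • s₂) u
      - (inner ℝ (H₁ s₁ + η₁ • s₁) u + inner ℝ (H₂ s₂ + η₂ • s₂) (-u)) := by
    rw [← real_inner_self_eq_norm_sq, inner_neg_right]
    nth_rw 1 [hu]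
    simp only [inner_sub_left, inner_add_left, real_inner_smul_left]
    ring
  have b1 : inner ℝ (H₁ s₂ - H₂ s₂) u ≤ δ * ‖u‖ := (real_inner_le_norm _ _).trans (by
    rw [norm_sub_rev]; gcongr; exact hδ _ h₂.1)
  have b2 : inner ℝ ((η₁ - η₂) • s₂) u ≤ |η₁ - η₂| * M * ‖u‖ := (real_inner_le_norm _ _).trans (by
    rw [norm_smul, Real.norm_eq_abs]; gcongr; exact hM _ h₂.1)
  rw [hu'] at a2
  have b3 : η₁ * ‖u‖ ^ 2 ≤ (δ + |η₁ - η₂| * M) * ‖u‖ := by linarith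
  have hδ0 : 0 ≤ δ := (norm_nonneg _).trans (hδ _ h₂.1)
  have hM0 : 0 ≤ M := (norm_nonneg _).trans (hM _ h₂.1)
  have b4 : ‖u‖ * η₁ ≤ δ + |η₁ - η₂| * M := by
    rcases (norm_nonneg u).eq_or_lt with h | h
    · rw [← h, zero_mul]; positivity
    · refine le_of_mul_le_mul_right ?_ h
      linarith
  have b5 : |1 - η₂ / η₁| = |η₁ - η₂| / η₁ := by
    rw [one_sub_div hη.ne', abs_div, abs_of_pos hη]
  rw [b5, mul_div_assoc', ← add_div, le_div_iff₀ hη]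
  linarith

/-- The regularized solutions converge to the least-norm solution if the perturbation of the
mapping at that solution is small compared to the regularization. -/
theorem tendsto_isLeastNormVISol (hcl : IsClosed X) (hbd : Bornology.IsBounded X)
    {H : ℕ → RSpace n → RSpace n}
    (hmono : ∀ k, ∀ x ∈ X, ∀ y ∈ X, 0 ≤ inner ℝ (H k x - H k y) (x - y))
    {η : ℕ → ℝ} (hη : ∀ k, 0 < η k) {s : ℕ → RSpace n}
    (hs : ∀ k, IsVISol X (regularizedMap (H k) (η k)) (s k))
    (hclus : ∀ p, MapClusterPt p atTop s → IsVISol X G p)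
    {t : RSpace n} (ht : IsLeastNormVISol X G t)
    (hrate : Tendsto (fun k => ‖H k t - G t‖ / η k) atTop (𝓝 0))
    (huniq : ∃! t, IsLeastNormVISol X G t) : Tendsto s atTop (𝓝 t) := by
  have hcpt : IsCompact X := Metric.isCompact_of_isClosed_isBounded hcl hbd
  refine hcpt.tendsto_nhds_of_unique_mapClusterPt (Eventually.of_forall fun k => (hs k).1) ?_
  intro p _ hp
  have hpsol := hclus p hp
  obtain ⟨D, hD⟩ := hbd.exists_norm_le
  -- The regularized inequality tested at `t`, the monotonicity of `H k` and the inequality of `t`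
  -- tested at `s k` cancel all but the error at `t`. In the limit `⟪p, p - t⟫ ≤ 0`, so `‖p‖ ≤ ‖t‖`.
  have key : ∀ k, inner ℝ (s k) (s k - t) ≤ ‖H k t - G t‖ / η k * (2 * D) := by
    intro k
    have a1 := (hs k).2 t ht.1.1
    have a2 := hmono k t ht.1.1 (s k) (hs k).1
    have a3 := ht.1.2 (s k) (hs k).1
    have a4 := real_inner_le_norm (H k t - G t) (t - s k)
    have a5 : ‖t - s k‖ ≤ 2 * D := by
      have := hD _ ht.1.1
      have := hD _ (hs k).1
      linarith [norm_sub_le t (s k)]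
    have a6 : ‖H k t - G t‖ * ‖t - s k‖ ≤ ‖H k t - G t‖ * (2 * D) := by gcongr
    simp only [regularizedMap] at a1
    have e : inner ℝ (H k t - G t) (t - s k) - η k * inner ℝ (s k) (s k - t) =
        inner ℝ (H k (s k) + η k • s k) (t - s k) + inner ℝ (H k t - H k (s k)) (t - s k)
        + inner ℝ (G t) (s k - t) := by
      simp only [inner_sub_left, inner_add_left, real_inner_smul_left, inner_sub_right]
      ring
    rw [div_mul_eq_mul_div, le_div_iff₀ (hη k)]
    linarith
  obtain ⟨ψ, hψ, hlim⟩ := hp.tendsto_subseq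
  have h1 : Tendsto (fun k => inner ℝ (s (ψ k)) (s (ψ k) - t)) atTop (𝓝 (inner ℝ p (p - t))) :=
    hlim.inner (𝕜 := ℝ) (hlim.sub tendsto_const_nhds)
  have h2 : inner ℝ p (p - t) ≤ 0 * (2 * D) :=
    le_of_tendsto_of_tendsto' h1 ((hrate.comp hψ.tendsto_atTop).mul_const _) fun k => key _
  rw [zero_mul, inner_sub_right, real_inner_self_eq_norm_sq] at h2
  have h3 := real_inner_le_norm p t
  have h4 : ‖p‖ ≤ ‖t‖ := by
    by_contra! h
    nlinarith [norm_nonneg t]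
  exact huniq.unique ⟨hpsol, fun y hy => h4.trans (ht.2 y hy)⟩ ht

end VariationalInequality

/-! ### Dependence of ball averages on the radius and the center. -/

section BallAverage

/-- Averages over two nested sets. -/
theorem norm_setAverage_sub_setAverage_le {α E : Type*} [MeasurableSpace α] [NormedAddCommGroup E]
    [NormedSpace ℝ E] {μ : Measure α} {f : α → E} {A B : Set α} {C : ℝ} (hAB : A ⊆ B)
    (hA : MeasurableSet A) (hA0 : μ A ≠ 0) (hB1 : μ B ≠ ⊤) (hB : MeasurableSet B)
    (hf : AEStronglyMeasurable f (μ.restrict B)) (hC : ∀ x ∈ B, ‖f x‖ ≤ C) :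
    ‖(⨍ x in A, f x ∂μ) - ⨍ x in B, f x ∂μ‖ ≤ 2 * C * (1 - μ.real A / μ.real B) := by
  have hA1 : μ A ≠ ⊤ := ((measure_mono hAB).trans_lt hB1.lt_top).ne
  have ha : 0 < μ.real A := ENNReal.toReal_pos hA0 hA1
  have hab : μ.real A ≤ μ.real B := measureReal_mono hAB hB1
  have hb : 0 < μ.real B := ha.trans_le hab
  have hint : IntegrableOn f B μ :=
    IntegrableOn.of_bound hB1.lt_top hf C ((ae_restrict_iff' hB).2 (ae_of_all _ hC))
  have hsplit : ∫ x in B, f x ∂μ = ∫ x in A, f x ∂μ + ∫ x in B \ A, f x ∂μ := by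
    rw [← setIntegral_union Set.disjoint_sdiff_right (hB.diff hA) (hint.mono_set hAB)
      (hint.mono_set Set.sdiff_subset), Set.union_sdiff_cancel hAB]
  have n1 : ‖∫ x in A, f x ∂μ‖ ≤ C * μ.real A :=
    norm_setIntegral_le_of_norm_le_const hA1.lt_top fun x hx => hC x (hAB hx)
  have n2 : ‖∫ x in B \ A, f x ∂μ‖ ≤ C * μ.real (B \ A) :=
    norm_setIntegral_le_of_norm_le_const ((measure_mono Set.sdiff_subset).trans_lt hB1.lt_top)
      fun x hx => hC x hx.1
  rw [measureReal_sdiff hAB hA hB1] at n2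
  -- The change of weight on `A` and the mass of `B \ A` each contribute `C (1 - μ A / μ B)`.
  rw [setAverage_eq, setAverage_eq, hsplit, smul_add, ← sub_sub, ← sub_smul]
  refine (norm_sub_le _ _).trans ?_
  have h0 : 0 ≤ (μ.real A)⁻¹ - (μ.real B)⁻¹ := sub_nonneg.2 (inv_anti₀ ha hab)
  rw [norm_smul, norm_smul, Real.norm_of_nonneg h0, Real.norm_of_nonneg (inv_nonneg.2 hb.le)]
  calc _ ≤ ((μ.real A)⁻¹ - (μ.real B)⁻¹) * (C * μ.real A)
        + (μ.real B)⁻¹ * (C * (μ.real B - μ.real A)) := by gcongr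
    _ = _ := by field_simp; ring

theorem measureReal_closedBall_pos {n : ℕ} (x : RSpace n) {r : ℝ} (hr : 0 < r) :
    0 < volume.real (Metric.closedBall x r) :=
  ENNReal.toReal_pos (Metric.measure_closedBall_pos volume x hr).ne' measure_closedBall_lt_top.ne

/-- Averages of a bounded mapping over two nested balls. -/
theorem norm_average_closedBall_sub_le {n : ℕ} {f : RSpace n → RSpace n}
    (hf : StronglyMeasurable f) {x y : RSpace n} {r R C : ℝ} (hr : 0 < r)
    (hsub : Metric.closedBall x r ⊆ Metric.closedBall y R) (hrR : r ≤ R)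
    (hC : ∀ u ∈ Metric.closedBall y R, ‖f u‖ ≤ C) :
    ‖(⨍ u in Metric.closedBall x r, f u) - ⨍ u in Metric.closedBall y R, f u‖ ≤
      2 * C * (n * (1 - r / R)) := by
  have hR : 0 < R := hr.trans_le hrR
  have hC0 : 0 ≤ C := (norm_nonneg _).trans (hC y (by simp [hR.le]))
  refine (norm_setAverage_sub_setAverage_le hsub measurableSet_closedBall
    (Metric.measure_closedBall_pos volume x hr).ne' measure_closedBall_lt_top.ne
    measurableSet_closedBall hf.aestronglyMeasurable hC).trans ?_
  gcongr
  have e : volume.real (Metric.closedBall x r) / volume.real (Metric.closedBall y R)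
      = (r / R) ^ n := by
    have h1 := measureReal_closedBall_pos (0 : RSpace n) one_pos
    rw [Measure.addHaar_real_closedBall' _ x hr.le, Measure.addHaar_real_closedBall' _ y hR.le,
      finrank_euclideanSpace, Fintype.card_fin, div_pow]
    field_simp
  rw [e]
  have h0 : 0 ≤ r / R := by positivity
  -- Bernoulli: `1 - (r / R)ⁿ ≤ n (1 - r / R)`.
  have := one_add_mul_le_pow (a := r / R - 1) (by linarith) n
  rw [add_sub_cancel] at this
  linarith

theorem norm_average_closedBall_le {n : ℕ} {f : RSpace n → RSpace n} {x : RSpace n} {r C : ℝ}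
    (hr : 0 < r) (hC : ∀ u ∈ Metric.closedBall x r, ‖f u‖ ≤ C) :
    ‖⨍ u in Metric.closedBall x r, f u‖ ≤ C := by
  have h := measureReal_closedBall_pos x hr
  rw [setAverage_eq, norm_smul, Real.norm_of_nonneg (inv_nonneg.2 h.le), inv_mul_le_iff₀ h,
    mul_comm]
  exact norm_setIntegral_le_of_norm_le_const measure_closedBall_lt_top hC

/-- Averages over balls of a fixed radius are Lipschitz in the center. -/
theorem norm_average_closedBall_sub_le_mul {n : ℕ} {f : RSpace n → RSpace n}
    (hf : StronglyMeasurable f) {x y : RSpace n} {r C : ℝ} (hr : 0 < r)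
    (hCx : ∀ u ∈ Metric.closedBall x r, ‖f u‖ ≤ C)
    (hCy : ∀ u ∈ Metric.closedBall y r, ‖f u‖ ≤ C) :
    ‖(⨍ u in Metric.closedBall x r, f u) - ⨍ u in Metric.closedBall y r, f u‖ ≤
      4 * C * (n + 1) / r * ‖x - y‖ := by
  have hC0 : 0 ≤ C := (norm_nonneg _).trans (hCx x (by simp [hr.le]))
  rcases le_or_gt r ‖x - y‖ with h | h
  · calc _ ≤ C + C := (norm_sub_le _ _).trans (add_le_add (norm_average_closedBall_le hr hCx)
          (norm_average_closedBall_le hr hCy))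
      _ ≤ 4 * C * (n + 1) / r * r := by
          rw [div_mul_cancel₀ _ hr.ne']
          have : 0 ≤ C * n := by positivity
          linarith
      _ ≤ _ := by gcongr
  -- The ball of radius `r - ‖x - y‖` about `x` lies in both balls, so its average serves as an
  -- intermediate term.
  · have h1 := norm_average_closedBall_sub_le (x := x) (r := r - ‖x - y‖) hf (by linarith)
      (Metric.closedBall_subset_closedBall (by linarith [norm_nonneg (x - y)]))
      (by linarith [norm_nonneg (x - y)]) hCx
    have h2 := norm_average_closedBall_sub_le (x := x) (r := r - ‖x - y‖) hf (by linarith)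
      (Metric.closedBall_subset_closedBall' (by rw [dist_eq_norm]; linarith))
      (by linarith [norm_nonneg (x - y)]) hCy
    have e : 2 * C * (n * (1 - (r - ‖x - y‖) / r)) = 2 * C * n / r * ‖x - y‖ := by
      field_simp; ring
    rw [e] at h1 h2
    rw [norm_sub_rev] at h1
    calc _ ≤ 2 * C * n / r * ‖x - y‖ + 2 * C * n / r * ‖x - y‖ :=
          (norm_sub_le_norm_sub_add_norm_sub _ _ _).trans (add_le_add h1 h2)
      _ = 4 * C * n / r * ‖x - y‖ := by ring
      _ ≤ _ := by gcongr; linarith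

end BallAverage

/-! ### Properties of the smoothed and regularized maps. -/

section Smoothing

variable {n d : ℕ} {Ω : Type*} [MeasurableSpace Ω] {P : Measure Ω} [IsProbabilityMeasure P]
  {X : Set (RSpace n)} {Φ : RSpace n → RSpace d → RSpace n} {ξ : Ω → RSpace d} {ε C : ℝ}
  {z : Ω → RSpace n} {r : ℝ}

theorem add_mem_enlargement {x u : RSpace n} (hx : x ∈ X) (hu : u ∈ Metric.closedBall 0 r)
    (hr : r ≤ ε) : x + u ∈ enlargement X ε :=
  Set.add_mem_add hx (Metric.closedBall_subset_closedBall hr hu)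

theorem mem_enlargement_of_mem_closedBall {x u : RSpace n} (hx : x ∈ X)
    (hu : u ∈ Metric.closedBall x r) (hr : r ≤ ε) : u ∈ enlargement X ε := by
  have h := add_mem_enlargement (u := u - x) (r := r) hx
    (by simpa [dist_eq_norm] using hu) hr
  rwa [add_sub_cancel] at h

theorem subset_enlargement (hε : 0 ≤ ε) : X ⊆ enlargement X ε := fun _ hx =>
  mem_enlargement_of_mem_closedBall hx (Metric.mem_closedBall_self hε) le_rfl

theorem ProblemAssumption.stronglyMeasurable_meanMap (h : ProblemAssumption P X Φ ξ ε C) :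
    StronglyMeasurable (meanMap P Φ ξ) := by
  have h1 : Measurable fun p : RSpace n × Ω => Φ p.1 (ξ p.2) :=
    h.measurable_Φ.comp (measurable_fst.prodMk (h.measurable_ξ.comp measurable_snd))
  exact h1.stronglyMeasurable.integral_prod_right'

theorem ProblemAssumption.norm_meanMap_le (h : ProblemAssumption P X Φ ξ ε C) {x : RSpace n}
    (hx : x ∈ enlargement X ε) : ‖meanMap P Φ ξ x‖ ≤ C := by
  obtain ⟨h1, h2⟩ := h.second_moment x hx
  have hC := h.C_pos
  calc ‖meanMap P Φ ξ x‖ ≤ ∫ ω, ‖Φ x (ξ ω)‖ ∂P := norm_integral_le_integral_norm _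
    -- Pointwise `a ≤ (a² + C²) / (2C)`, used in place of Cauchy–Schwarz for the expectation.
    _ ≤ ∫ ω, (‖Φ x (ξ ω)‖ ^ 2 + C ^ 2) / (2 * C) ∂P := by
        refine integral_mono_of_nonneg (ae_of_all _ fun _ => norm_nonneg _)
          ((h1.add (integrable_const _)).div_const _) (ae_of_all _ fun ω => ?_)
        rw [le_div_iff₀ (by positivity)]
        nlinarith [sq_nonneg (‖Φ x (ξ ω)‖ - C)]
    _ = (∫ ω, ‖Φ x (ξ ω)‖ ^ 2 ∂P + C ^ 2) / (2 * C) := by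
        rw [integral_div, integral_add h1 (integrable_const _)]
        simp
    _ ≤ (C ^ 2 + C ^ 2) / (2 * C) := by gcongr
    _ = C := by field_simp; ring

theorem ae_mem_closedBall_of_isUniform (hr : 0 < r) (hzm : Measurable z)
    (hz : pdf.IsUniform z (Metric.closedBall (0 : RSpace n) r) P volume) :
    ∀ᵐ ω ∂P, z ω ∈ Metric.closedBall 0 r := by
  have h0 : volume (Metric.closedBall (0 : RSpace n) r) ≠ 0 :=
    (Metric.measure_closedBall_pos volume _ hr).ne'
  have h := hz.measure_preimage h0 measure_closedBall_lt_top.ne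
    (measurableSet_closedBall (x := (0 : RSpace n)) (ε := r))
  rw [Set.inter_self, ENNReal.div_self h0 measure_closedBall_lt_top.ne] at h
  exact (prob_compl_eq_zero_iff (hzm measurableSet_closedBall)).2 h

omit [IsProbabilityMeasure P] in
-- This reduces comparisons of smoothed maps, at different points or radii, to comparisons of ball
-- averages.
theorem smoothedMap_eq_average {G : RSpace n → RSpace n} (hG : StronglyMeasurable G)
    (hzm : Measurable z)
    (hz : pdf.IsUniform z (Metric.closedBall (0 : RSpace n) r) P volume) (x : RSpace n) :
    smoothedMap P G z x = ⨍ u in Metric.closedBall x r, G u := by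
  have h1 : smoothedMap P G z x = ∫ u, G (x + u) ∂(P.map z) := by
    rw [integral_map hzm.aemeasurable]
    · rfl
    · exact (hG.comp_measurable (measurable_const_add x)).aestronglyMeasurable
  have h2 : (x + ·) ⁻¹' Metric.closedBall x r = Metric.closedBall (0 : RSpace n) r := by
    ext u; simp [dist_eq_norm]
  rw [h1, hz, ProbabilityTheory.cond, integral_smul_measure, setAverage_eq, ← h2,
    (measurePreserving_add_left volume x).setIntegral_preimage_emb
      (measurableEmbedding_addLeft x), measureReal_def, ENNReal.toReal_inv,
    measure_preimage_add]

variable (h : ProblemAssumption P X Φ ξ ε C) (hr : 0 < r) (hrε : r ≤ ε) (hzm : Measurable z)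
  (hz : pdf.IsUniform z (Metric.closedBall (0 : RSpace n) r) P volume)

include h hr hrε hzm hz

theorem ProblemAssumption.integrable_meanMap_add {x : RSpace n} (hx : x ∈ X) :
    Integrable (fun ω => meanMap P Φ ξ (x + z ω)) P := by
  refine Integrable.of_bound
    (h.stronglyMeasurable_meanMap.comp_measurable (hzm.const_add x)).aestronglyMeasurable C ?_
  filter_upwards [ae_mem_closedBall_of_isUniform hr hzm hz] with ω hω
  exact h.norm_meanMap_le (add_mem_enlargement hx hω hrε)

theorem ProblemAssumption.smoothedMap_monotone {x y : RSpace n} (hx : x ∈ X) (hy : y ∈ X) :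
    0 ≤ inner ℝ (smoothedMap P (meanMap P Φ ξ) z x - smoothedMap P (meanMap P Φ ξ) z y)
      (x - y) := by
  have hix := h.integrable_meanMap_add hr hrε hzm hz hx
  have hiy := h.integrable_meanMap_add hr hrε hzm hz hy
  rw [smoothedMap, smoothedMap, ← integral_sub hix hiy, real_inner_comm,
    ← integral_inner (f := fun ω => meanMap P Φ ξ (x + z ω) - meanMap P Φ ξ (y + z ω))
      (hix.sub hiy)]
  refine integral_nonneg_of_ae ?_
  filter_upwards [ae_mem_closedBall_of_isUniform hr hzm hz] with ω hω
  have := h.monotone _ (add_mem_enlargement hx hω hrε) _ (add_mem_enlargement hy hω hrε)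
  rwa [add_sub_add_right_eq_sub, real_inner_comm] at this

theorem ProblemAssumption.norm_smoothedMap_sub_meanMap_le {x : RSpace n} (hx : x ∈ X) {δ : ℝ}
    (hδ : ∀ u ∈ Metric.closedBall x r, ‖meanMap P Φ ξ u - meanMap P Φ ξ x‖ ≤ δ) :
    ‖smoothedMap P (meanMap P Φ ξ) z x - meanMap P Φ ξ x‖ ≤ δ := by
  have e : smoothedMap P (meanMap P Φ ξ) z x - meanMap P Φ ξ x =
      ∫ ω, (meanMap P Φ ξ (x + z ω) - meanMap P Φ ξ x) ∂P := by
    rw [integral_sub (h.integrable_meanMap_add hr hrε hzm hz hx) (integrable_const _)]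
    simp [smoothedMap]
  rw [e]
  refine (norm_integral_le_of_norm_le_const (C := δ) ?_).trans (by simp)
  filter_upwards [ae_mem_closedBall_of_isUniform hr hzm hz] with ω hω
  exact hδ _ (by simpa [dist_eq_norm] using hω)

theorem ProblemAssumption.norm_smoothedMap_sub_le {x y : RSpace n} (hx : x ∈ X) (hy : y ∈ X) :
    ‖smoothedMap P (meanMap P Φ ξ) z x - smoothedMap P (meanMap P Φ ξ) z y‖ ≤
      4 * C * (n + 1) / r * ‖x - y‖ := by
  rw [smoothedMap_eq_average h.stronglyMeasurable_meanMap hzm hz,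
    smoothedMap_eq_average h.stronglyMeasurable_meanMap hzm hz]
  exact norm_average_closedBall_sub_le_mul h.stronglyMeasurable_meanMap hr
    (fun u hu => h.norm_meanMap_le (mem_enlargement_of_mem_closedBall hx hu hrε))
    (fun u hu => h.norm_meanMap_le (mem_enlargement_of_mem_closedBall hy hu hrε))

theorem ProblemAssumption.regularizedMap_stronglyMonotone (η : ℝ) {x y : RSpace n} (hx : x ∈ X)
    (hy : y ∈ X) :
    η * ‖x - y‖ ^ 2 ≤ inner ℝ (regularizedMap (smoothedMap P (meanMap P Φ ξ) z) η x -
      regularizedMap (smoothedMap P (meanMap P Φ ξ) z) η y) (x - y) := by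
  have h1 := h.smoothedMap_monotone hr hrε hzm hz hx hy
  rw [regularizedMap, regularizedMap, add_sub_add_comm, ← smul_sub, inner_add_left,
    real_inner_smul_left, real_inner_self_eq_norm_sq]
  linarith

/-- The Lipschitz constant degenerates as `r → 0`, but it serves only here, at a fixed radius. -/
theorem ProblemAssumption.existsUnique_isVISol_regularizedMap {η : ℝ} (hη : 0 < η) :
    ∃! s, IsVISol X (regularizedMap (smoothedMap P (meanMap P Φ ξ) z) η) s := by
  have hne : X.Nonempty := h.solvable.imp fun _ hx => hx.1
  have hmono := fun x hx y hy =>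
    h.regularizedMap_stronglyMonotone hr hrε hzm hz η (x := x) (y := y) hx hy
  obtain ⟨s, hs⟩ := exists_isVISol_of_stronglyMonotone (L := 4 * C * (n + 1) / r + η) hne
    h.closed h.convex hη hmono (fun x hx y hy => by
      rw [regularizedMap, regularizedMap, add_sub_add_comm, ← smul_sub, add_mul]
      refine (norm_add_le _ _).trans (add_le_add
        (h.norm_smoothedMap_sub_le hr hrε hzm hz hx hy) ?_)
      rw [norm_smul, Real.norm_of_nonneg hη.le])
  exact ⟨s, hs, fun t ht => ht.eq_of_stronglyMonotone hη hmono hs⟩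

omit hr in
theorem ProblemAssumption.norm_smoothedMap_sub_smoothedMap_le_of_le {z' : Ω → RSpace n} {r' : ℝ}
    (hr' : 0 < r') (hzm' : Measurable z')
    (hz' : pdf.IsUniform z' (Metric.closedBall (0 : RSpace n) r') P volume) (hrr : r' ≤ r)
    {x : RSpace n} (hx : x ∈ X) :
    ‖smoothedMap P (meanMap P Φ ξ) z' x - smoothedMap P (meanMap P Φ ξ) z x‖ ≤
      2 * C * (n * (1 - r' / r)) := by
  rw [smoothedMap_eq_average h.stronglyMeasurable_meanMap hzm hz,
    smoothedMap_eq_average h.stronglyMeasurable_meanMap hzm' hz']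
  exact norm_average_closedBall_sub_le h.stronglyMeasurable_meanMap hr'
    (Metric.closedBall_subset_closedBall hrr) hrr
    (fun u hu => h.norm_meanMap_le (mem_enlargement_of_mem_closedBall hx hu hrε))

theorem ProblemAssumption.norm_smoothedMap_sub_smoothedMap_le {z' : Ω → RSpace n} {r' : ℝ}
    (hr' : 0 < r') (hrε' : r' ≤ ε) (hzm' : Measurable z')
    (hz' : pdf.IsUniform z' (Metric.closedBall (0 : RSpace n) r') P volume)
    {x : RSpace n} (hx : x ∈ X) :
    ‖smoothedMap P (meanMap P Φ ξ) z' x - smoothedMap P (meanMap P Φ ξ) z x‖ ≤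
      2 * C * n * (1 - min r' r / max r' r) := by
  rw [mul_assoc (2 * C)]
  rcases le_total r' r with hle | hle
  · rw [min_eq_left hle, max_eq_right hle]
    exact h.norm_smoothedMap_sub_smoothedMap_le_of_le hrε hzm hz hr' hzm' hz' hle hx
  · rw [min_eq_right hle, max_eq_left hle, norm_sub_rev]
    exact h.norm_smoothedMap_sub_smoothedMap_le_of_le hrε' hzm' hz' hr hzm hz hle hx

end Smoothing

/-! ### Limits of the regularized solutions. -/

section Regularization

variable {n d : ℕ} {Ω : Type*} [MeasurableSpace Ω] {P : Measure Ω} [IsProbabilityMeasure P]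
  {X : Set (RSpace n)} {Φ : RSpace n → RSpace d → RSpace n} {ξ : Ω → RSpace d} {ε C : ℝ}
  {γ η εs : ℕ → ℝ} {x0 : Ω → RSpace n} {ξs : ℕ → Ω → RSpace d} {z : ℕ → Ω → RSpace n}
  (h : ProblemAssumption P X Φ ξ ε C) (hrand : RandomInputAssumption P X ξ εs x0 ξs z)
  (htune : TuningAssumption n ε C γ η εs)

include h hrand htune

theorem ProblemAssumption.tendsto_smoothedMap {y : RSpace n} (hy : y ∈ X) :
    Tendsto (fun k => smoothedMap P (meanMap P Φ ξ) (z k) y) atTop (𝓝 (meanMap P Φ ξ y)) := by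
  rw [Metric.tendsto_nhds]
  intro δ hδ
  have hε : 0 ≤ ε := (htune.εs_pos 0).le.trans (htune.cond_c 0)
  obtain ⟨ρ, hρ, hc⟩ := Metric.continuousWithinAt_iff.1
    (h.continuous y (subset_enlargement hε hy)) (δ / 2) (by positivity)
  filter_upwards [htune.εs_lim.eventually_lt_const hρ] with k hk
  rw [dist_eq_norm]
  refine (h.norm_smoothedMap_sub_meanMap_le (htune.εs_pos k) (htune.cond_c k)
    (hrand.measurable_z k) (hrand.uniform_z k) hy (δ := δ / 2) fun u hu => ?_).trans_lt
    (by linarith)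
  rw [← dist_eq_norm]
  exact (hc (mem_enlargement_of_mem_closedBall hy hu (htune.cond_c k))
    ((Metric.mem_closedBall.1 hu).trans_lt hk)).le

/-- In Minty's form the maps are evaluated only at a fixed `y`, so pointwise convergence `F_k y → F
y` suffices. -/
theorem ProblemAssumption.isVISol_of_mapClusterPt_regularized {s : ℕ → RSpace n}
    (hs : ∀ k, IsVISol X (regularizedMap (smoothedMap P (meanMap P Φ ξ) (z k)) (η k)) (s k))
    {p : RSpace n} (hp : MapClusterPt p atTop s) : IsVISol X (meanMap P Φ ξ) p := by
  have hε : 0 ≤ ε := (htune.εs_pos 0).le.trans (htune.cond_c 0)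
  refine isVISol_of_mapClusterPt h.closed h.convex
    (fun x hx y hy => h.monotone x (subset_enlargement hε hx) y (subset_enlargement hε hy))
    (h.continuous.mono (subset_enlargement hε))
    (H := fun k => regularizedMap (smoothedMap P (meanMap P Φ ξ) (z k)) (η k))
    (fun y hy => ?_) (fun k => (hs k).1) (fun k y hy => ?_) hp
  · have h1 := (h.tendsto_smoothedMap hrand htune hy).add (htune.η_lim.smul_const y)
    simpa [regularizedMap] using h1
  · have h1 := h.regularizedMap_stronglyMonotone (htune.εs_pos k) (htune.cond_c k)
      (hrand.measurable_z k) (hrand.uniform_z k) (η k) hy (hs k).1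
    have h2 := (hs k).2 y hy
    rw [inner_sub_left] at h1
    have h3 : 0 ≤ η k * ‖y - s k‖ ^ 2 := mul_nonneg (htune.η_pos k).le (sq_nonneg _)
    linarith

omit [IsProbabilityMeasure P] hrand in
theorem ProblemAssumption.existsUnique_isLeastNormVISol_meanMap :
    ∃! t, IsLeastNormVISol X (meanMap P Φ ξ) t := by
  have hε : 0 ≤ ε := (htune.εs_pos 0).le.trans (htune.cond_c 0)
  exact existsUnique_isLeastNormVISol h.closed h.convex
    (fun x hx y hy => h.monotone x (subset_enlargement hε hx) y (subset_enlargement hε hy))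
    (h.continuous.mono (subset_enlargement hε)) h.solvable

theorem ProblemAssumption.tendsto_regularized_isLeastNormVISol {s : ℕ → RSpace n}
    (hs : ∀ k, IsVISol X (regularizedMap (smoothedMap P (meanMap P Φ ξ) (z k)) (η k)) (s k))
    {t : RSpace n} (ht : IsLeastNormVISol X (meanMap P Φ ξ) t)
    (hrate : Tendsto (fun k => εs k / η k) atTop (𝓝 0))
    (hJ : BoundedJacobianNear (meanMap P Φ ξ) t) : Tendsto s atTop (𝓝 t) := by
  obtain ⟨ρ, hρ, J, hJ⟩ := hJ
  refine tendsto_isLeastNormVISol h.closed h.bounded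
    (fun k x hx y hy => h.smoothedMap_monotone (htune.εs_pos k) (htune.cond_c k)
      (hrand.measurable_z k) (hrand.uniform_z k) hx hy) htune.η_pos hs
    (fun p hp => h.isVISol_of_mapClusterPt_regularized hrand htune hs hp) ht ?_
    (h.existsUnique_isLeastNormVISol_meanMap htune)
  have hlim : Tendsto (fun k => J * (εs k / η k)) atTop (𝓝 0) := by
    simpa using hrate.const_mul J
  have hJ0 : 0 ≤ J := (norm_nonneg _).trans (hJ t (Metric.mem_ball_self hρ)).2
  refine squeeze_zero' (Eventually.of_forall fun k =>
    div_nonneg (norm_nonneg _) (htune.η_pos k).le) ?_ hlim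
  filter_upwards [htune.εs_lim.eventually_lt_const hρ] with k hk
  rw [mul_div_assoc']
  refine div_le_div_of_nonneg_right ?_ (htune.η_pos k).le
  refine h.norm_smoothedMap_sub_meanMap_le (htune.εs_pos k) (htune.cond_c k)
    (hrand.measurable_z k) (hrand.uniform_z k) ht.1.1 fun u hu => ?_
  have hu' : dist u t ≤ εs k := hu
  refine ((convex_ball t ρ).norm_image_sub_le_of_norm_fderiv_le (𝕜 := ℝ)
    (fun x hx => (hJ x hx).1) (fun x hx => (hJ x hx).2) (Metric.mem_ball_self hρ)
    (Metric.mem_ball.2 (hu'.trans_lt hk))).trans ?_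
  rw [← dist_eq_norm]
  gcongr

end Regularization

/-! ### Independence and freezing of one variable. -/

section Independence

variable {Ω α β δ τ E : Type*} [MeasurableSpace Ω] {P : Measure Ω}
  [MeasurableSpace α] [MeasurableSpace β] [MeasurableSpace δ] [MeasurableSpace τ]
  [NormedAddCommGroup E]

omit [MeasurableSpace Ω] in
theorem comap_prod_eq_generateFrom (f : Ω → α × β) :
    MeasurableSpace.comap f inferInstance = MeasurableSpace.generateFrom {t | ∃ s ∈
      Set.image2 (· ×ˢ ·) {s : Set α | MeasurableSet s} {t : Set β | MeasurableSet t},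
        f ⁻¹' s = t} := by
  rw [← generateFrom_prod, MeasurableSpace.comap_generateFrom]
  rfl

/-- Transposing a two-by-two array of independent random variables. -/
theorem indepFun_prodMk_transpose [IsProbabilityMeasure P] {A : Ω → α} {B : Ω → β} {C : Ω → δ}
    {D : Ω → τ} (hA : Measurable A) (hB : Measurable B) (hC : Measurable C) (hD : Measurable D)
    (hAB : IndepFun A B P) (hCD : IndepFun C D P)
    (h : IndepFun (fun ω => (A ω, B ω)) (fun ω => (C ω, D ω)) P) :
    IndepFun (fun ω => (A ω, C ω)) (fun ω => (B ω, D ω)) P := by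
  rw [IndepFun_iff_Indep]
  refine IndepSets.indep (hA.prodMk hC).comap_le (hB.prodMk hD).comap_le (isPiSystem_prod.comap _)
    (isPiSystem_prod.comap _) (comap_prod_eq_generateFrom _) (comap_prod_eq_generateFrom _) ?_
  rw [IndepSets_iff]
  rintro _ _ ⟨_, ⟨a, ha, c, hc, rfl⟩, rfl⟩ ⟨_, ⟨b, hb, e, he, rfl⟩, rfl⟩
  -- It suffices to test rectangles, and a pair of rectangles in one grouping is a pair of
  -- rectangles in the other.
  have h1 : (fun ω => (A ω, C ω)) ⁻¹' a ×ˢ c ∩ (fun ω => (B ω, D ω)) ⁻¹' b ×ˢ e =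
      (fun ω => (A ω, B ω)) ⁻¹' a ×ˢ b ∩ (fun ω => (C ω, D ω)) ⁻¹' c ×ˢ e := by
    ext ω; simp; tauto
  have hAC : IndepFun A C P := h.comp measurable_fst measurable_fst
  have hBD : IndepFun B D P := h.comp measurable_snd measurable_snd
  rw [h1, h.measure_inter_preimage_eq_mul _ _ (ha.prod hb) (hc.prod he), Set.mk_preimage_prod,
    Set.mk_preimage_prod, Set.mk_preimage_prod, Set.mk_preimage_prod,
    hAB.measure_inter_preimage_eq_mul _ _ ha hb, hCD.measure_inter_preimage_eq_mul _ _ hc he,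
    hAC.measure_inter_preimage_eq_mul _ _ ha hc, hBD.measure_inter_preimage_eq_mul _ _ hb he]
  ring

/-- The initial segment of an independent sequence is independent of the next term. -/
theorem indepFun_initialSegment [Zero α] {f : ℕ → Ω → α} (hf : iIndepFun f P)
    (hm : ∀ j, Measurable (f j)) (k : ℕ) :
    IndepFun (fun ω j => if j < k then f j ω else 0) (f k) P := by
  have h := hf.indepFun_finset (Finset.range k) {k} (by simp) hm
  -- Padding by zeros places the finite block in a space that does not depend on `k`.
  have h1 : Measurable fun (u : Finset.range k → α) (j : ℕ) =>
      if hj : j < k then u ⟨j, Finset.mem_range.2 hj⟩ else 0 := by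
    refine measurable_pi_lambda _ fun j => ?_
    by_cases hj : j < k
    · simp only [hj, dite_true]; exact measurable_pi_apply _
    · simp only [hj, dite_false]; exact measurable_const
  have h2 : Measurable fun u : ({k} : Finset ℕ) → α => u ⟨k, by simp⟩ := measurable_pi_apply _
  have := h.comp h1 h2
  convert this using 1
  · ext ω j
    by_cases hj : j < k <;> simp [hj]
  · rfl

variable [IsProbabilityMeasure P] {U : Ω → α} {V : Ω → β}

/-- Integration of a function of two independent random variables, one variable at a time. -/
theorem integral_comp_eq_of_indepFun [NormedSpace ℝ E] (hU : Measurable U) (hV : Measurable V)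
    (hUV : IndepFun U V P) {g : α × β → E} (hg : StronglyMeasurable g)
    (hint : Integrable (fun ω => g (U ω, V ω)) P) :
    ∫ ω, g (U ω, V ω) ∂P = ∫ ω, ∫ ω', g (U ω, V ω') ∂P ∂P := by
  have := Measure.isProbabilityMeasure_map (μ := P) hV.aemeasurable
  have hlaw := (indepFun_iff_map_prod_eq_prod_map_map hU.aemeasurable hV.aemeasurable).1 hUV
  have hint' : Integrable g ((P.map U).prod (P.map V)) := by
    rw [← hlaw, integrable_map_measure hg.aestronglyMeasurable (hU.prodMk hV).aemeasurable]
    exact hint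
  have h1 : ∫ ω, g (U ω, V ω) ∂P = ∫ p, g p ∂(P.map fun ω => (U ω, V ω)) :=
    (integral_map (hU.prodMk hV).aemeasurable hg.aestronglyMeasurable).symm
  rw [h1, hlaw, integral_prod _ hint', integral_map hU.aemeasurable
    hg.integral_prod_right'.aestronglyMeasurable]
  refine integral_congr_ae (ae_of_all _ fun ω => ?_)
  exact integral_map hV.aemeasurable
    (hg.comp_measurable measurable_prodMk_left).aestronglyMeasurable

theorem integrable_comp_of_indepFun (hU : Measurable U) (hV : Measurable V)
    (hUV : IndepFun U V P) {g : α × β → E} (hg : StronglyMeasurable g) {K : ℝ}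
    (hK : ∀ᵐ ω ∂P, Integrable (fun ω' => g (U ω, V ω')) P ∧ ∫ ω', ‖g (U ω, V ω')‖ ∂P ≤ K) :
    Integrable (fun ω => g (U ω, V ω)) P := by
  have := Measure.isProbabilityMeasure_map (μ := P) hU.aemeasurable
  have := Measure.isProbabilityMeasure_map (μ := P) hV.aemeasurable
  have hlaw := (indepFun_iff_map_prod_eq_prod_map_map hU.aemeasurable hV.aemeasurable).1 hUV
  have hsec : ∀ a, StronglyMeasurable fun b => g (a, b) := fun a =>
    hg.comp_measurable measurable_prodMk_left
  suffices hint : Integrable g (P.map fun ω => (U ω, V ω)) from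
    (integrable_map_measure hg.aestronglyMeasurable (hU.prodMk hV).aemeasurable).1 hint
  rw [hlaw, integrable_prod_iff hg.aestronglyMeasurable]
  have hmeas : Measurable fun a => ∫ b, ‖g (a, b)‖ ∂(P.map V) :=
    hg.norm.integral_prod_right'.measurable
  constructor
  · have hset : MeasurableSet {a | Integrable (fun b => g (a, b)) (P.map V)} :=
      measurableSet_integrable hg
    rw [ae_map_iff hU.aemeasurable hset]
    filter_upwards [hK] with ω hω
    exact (integrable_map_measure (hsec _).aestronglyMeasurable hV.aemeasurable).2 hω.1
  · refine Integrable.of_bound hmeas.aestronglyMeasurable K ?_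
    rw [ae_map_iff hU.aemeasurable (measurableSet_le hmeas.norm measurable_const)]
    filter_upwards [hK] with ω hω
    rw [integral_map hV.aemeasurable (hsec _).norm.aestronglyMeasurable,
      Real.norm_of_nonneg (integral_nonneg fun _ => norm_nonneg _)]
    exact hω.2

/-- With `I` the indicator of an event of the past, this yields the conditional estimate over that
event without conditional expectations. -/
theorem integral_mul_comp_le_of_indepFun {I : Ω → ℝ} (hI : Measurable I) (hU : Measurable U)
    (hV : Measurable V) (hI0 : ∀ ω, 0 ≤ I ω) (hI1 : ∀ ω, I ω ≤ 1)
    (hind : IndepFun (fun ω => (I ω, U ω)) V P) {g : α × β → ℝ}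
    (hg : Measurable g) {B : ℝ} (hgB : ∀ ω ω', ‖g (U ω, V ω')‖ ≤ B) {ψ : α → ℝ}
    (hψ : Integrable (fun ω => ψ (U ω)) P)
    (hle : ∀ ω, ∫ ω', g (U ω, V ω') ∂P ≤ ψ (U ω)) :
    ∫ ω, I ω * g (U ω, V ω) ∂P ≤ ∫ ω, I ω * ψ (U ω) ∂P := by
  have hgm : Measurable fun p : (ℝ × α) × β => p.1.1 * g (p.1.2, p.2) := by fun_prop
  have hbound : ∀ ω ω', ‖I ω * g (U ω, V ω')‖ ≤ B := fun ω ω' => by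
    rw [norm_mul, Real.norm_of_nonneg (hI0 ω)]
    exact (mul_le_of_le_one_left (norm_nonneg _) (hI1 ω)).trans (hgB ω ω')
  have hint : Integrable (fun ω => I ω * g (U ω, V ω)) P :=
    Integrable.of_bound (C := B) (hgm.comp ((hI.prodMk hU).prodMk hV)).aestronglyMeasurable
      (ae_of_all _ fun ω => hbound ω ω)
  have key := integral_comp_eq_of_indepFun (hI.prodMk hU) hV hind hgm.stronglyMeasurable hint
  have hmeas : StronglyMeasurable fun ω => ∫ ω', I ω * g (U ω, V ω') ∂P := by
    have h1 : Measurable fun p : Ω × Ω => ((I p.1, U p.1), V p.2) := by fun_prop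
    exact (hgm.comp h1).stronglyMeasurable.integral_prod_right'
  refine key.trans_le (integral_mono (Integrable.of_bound (C := B) hmeas.aestronglyMeasurable
    (ae_of_all _ fun ω => ?_)) (hψ.bdd_mul (c := 1) hI.aestronglyMeasurable
      (ae_of_all _ fun ω => ?_)) fun ω => ?_)
  · exact (norm_integral_le_of_norm_le_const (ae_of_all _ fun ω' => hbound ω ω')).trans (by simp)
  · rw [Real.norm_of_nonneg (hI0 ω)]; exact hI1 ω
  · simp only [integral_const_mul]
    exact mul_le_mul_of_nonneg_left (hle ω) (hI0 ω)

omit [MeasurableSpace Ω] in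
/-- A bound on the integrals over the second of two independent variables, with the first one
frozen, holds on every event of the first one. -/
theorem setIntegral_comp_le_of_indep {m : MeasurableSpace Ω} {mΩ : MeasurableSpace Ω}
    {P : Measure Ω} [IsProbabilityMeasure P] (hm : m ≤ mΩ)
    (hU : Measurable[m] U) (hV : Measurable V)
    (hind : Indep m (MeasurableSpace.comap V inferInstance) P) {g : α × β → ℝ}
    (hg : Measurable g) {B : ℝ} (hgB : ∀ ω ω', ‖g (U ω, V ω')‖ ≤ B) {ψ : α → ℝ}
    (hψ : Integrable (fun ω => ψ (U ω)) P)
    (hle : ∀ ω, ∫ ω', g (U ω, V ω') ∂P ≤ ψ (U ω)) {A : Set Ω} (hA : MeasurableSet[m] A) :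
    ∫ ω in A, g (U ω, V ω) ∂P ≤ ∫ ω in A, ψ (U ω) ∂P := by
  have hA' := hm A hA
  have hI : Measurable[m] (A.indicator (fun _ => (1 : ℝ))) :=
    Measurable.indicator (m := m) measurable_const hA
  have hIU : Measurable[m] fun ω => (A.indicator (fun _ => (1 : ℝ)) ω, U ω) :=
    Measurable.prodMk (m := m) hI hU
  have hIV : IndepFun (fun ω => (A.indicator (fun _ => (1 : ℝ)) ω, U ω)) V P := by
    rw [IndepFun_iff_Indep]
    exact indep_of_indep_of_le_left hind (measurable_iff_comap_le.1 hIU)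
  have e : ∀ f : Ω → ℝ, ∫ ω in A, f ω ∂P = ∫ ω, A.indicator (fun _ => (1 : ℝ)) ω * f ω ∂P :=
    fun f => by
    rw [← integral_indicator hA']
    refine integral_congr_ae (ae_of_all _ fun ω => ?_)
    by_cases h : ω ∈ A <;> simp [h]
  rw [e, e]
  refine integral_mul_comp_le_of_indepFun (hI.mono hm le_rfl) (hU.mono hm le_rfl) hV
    (fun ω => ?_) (fun ω => ?_) hIV hg hgB hψ hle
  · by_cases h : ω ∈ A <;> simp [h]
  · by_cases h : ω ∈ A <;> simp [h]

end Independence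

/-! ### Almost-supermartingale convergence. -/

/-- Almost sure convergence to zero of a bounded nonnegative almost-supermartingale. -/
theorem ae_tendsto_zero_of_setIntegral_le {Ω : Type*} {mΩ : MeasurableSpace Ω} {P : Measure Ω}
    [IsProbabilityMeasure P] {𝒢 : Filtration ℕ mΩ} {w : ℕ → Ω → ℝ} {θ c : ℕ → ℝ} {B : ℝ}
    (hadp : ∀ k, Measurable[𝒢 k] (w k)) (hw0 : ∀ k ω, 0 ≤ w k ω) (hwB : ∀ k ω, w k ω ≤ B)
    (hθ : ∀ k, 0 ≤ θ k) (hθsum : ¬ Summable θ) (hc0 : ∀ k, 0 ≤ c k) (hc : Summable c)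
    (hstep : ∀ k, ∀ A, MeasurableSet[𝒢 k] A →
      ∫ ω in A, w (k + 1) ω ∂P ≤ (1 - θ k) * ∫ ω in A, w k ω ∂P + c k * P.real A) :
    ∀ᵐ ω ∂P, Tendsto (fun k => w k ω) atTop (𝓝 0) := by
  have hwm : ∀ k, Measurable (w k) := fun k => (hadp k).mono (𝒢.le k) le_rfl
  have hwb : ∀ k, ∀ᵐ ω ∂P, ‖w k ω‖ ≤ B := fun k => ae_of_all _ fun ω => by
    rw [Real.norm_of_nonneg (hw0 k ω)]; exact hwB k ω
  have hwi : ∀ k, Integrable (w k) P := fun k =>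
    Integrable.of_bound (hwm k).aestronglyMeasurable B (hwb k)
  set S : ℕ → ℝ := fun k => ∑ j ∈ Finset.range k, c j
  have hSle : ∀ k, S k ≤ ∑' j, c j := fun k => hc.sum_le_tsum _ fun j _ => hc0 j
  have hS0 : ∀ k, 0 ≤ S k := fun k => Finset.sum_nonneg fun j _ => hc0 j
  have hfi : ∀ k, Integrable (fun ω => S k - w k ω) P := fun k =>
    (integrable_const _).sub (hwi k)
  -- Without the term in `θ`, adding back the accumulated errors gives a bounded submartingale,
  -- which converges almost surely.
  have hsub : Submartingale (fun k ω => S k - w k ω) 𝒢 P := by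
    refine submartingale_of_setIntegral_le_succ
      (fun k => (measurable_const.sub (hadp k)).stronglyMeasurable) hfi fun k A hA => ?_
    have h1 := hstep k A hA
    have h2 : 0 ≤ ∫ ω in A, w k ω ∂P := integral_nonneg fun ω => hw0 k ω
    rw [integral_sub (integrable_const _).integrableOn (hwi _).integrableOn,
      integral_sub (integrable_const _).integrableOn (hwi _).integrableOn, setIntegral_const,
      setIntegral_const, smul_eq_mul, smul_eq_mul]
    have h3 : S (k + 1) = S k + c k := Finset.sum_range_succ _ _
    rw [h3]
    nlinarith [mul_nonneg (hθ k) h2]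
  have hB0 : 0 ≤ B := by
    have : Nonempty Ω := P.nonempty_of_neZero
    exact (hw0 0 this.some).trans (hwB 0 _)
  have hconv := hsub.exists_ae_tendsto_of_bdd (R := (B + ∑' j, c j).toNNReal) fun k => by
    refine (eLpNorm_le_of_ae_bound (C := B + ∑' j, c j) (ae_of_all _ fun ω => ?_)).trans ?_
    · rw [Real.norm_eq_abs, abs_le]
      constructor <;> linarith [hw0 k ω, hwB k ω, hS0 k, hSle k]
    · simp [ENNReal.ofReal]
  have hconv' : ∀ᵐ ω ∂P, ∃ l, Tendsto (fun k => w k ω) atTop (𝓝 l) := by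
    filter_upwards [hconv] with ω ⟨l, hl⟩
    refine ⟨_, (hc.hasSum.tendsto_sum_nat.sub hl).congr fun k => ?_⟩
    simp [S]
  obtain ⟨g, hgm, hg⟩ := measurable_limit_of_tendsto_metrizable_ae
    (fun k => (hwm k).aemeasurable) hconv'
  have hEg : Tendsto (fun k => ∫ ω, w k ω ∂P) atTop (𝓝 (∫ ω, g ω ∂P)) :=
    tendsto_integral_of_dominated_convergence (fun _ => B)
      (fun k => (hwm k).aestronglyMeasurable) (integrable_const _) hwb hg
  have hg0 : 0 ≤ᵐ[P] g := by
    filter_upwards [hg] with ω hω using ge_of_tendsto' hω fun k => hw0 k ω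
  have hgi : Integrable g P := by
    refine Integrable.of_bound hgm.aestronglyMeasurable B ?_
    filter_upwards [hg, hg0] with ω hω hω0
    rw [Real.norm_of_nonneg hω0]
    exact le_of_tendsto' hω fun k => hwB k ω
  have hE0 : ∀ k, 0 ≤ ∫ ω, w k ω ∂P := fun k => integral_nonneg fun ω => hw0 k ω
  have hrec : ∀ k, θ k * ∫ ω, w k ω ∂P ≤ ∫ ω, w k ω ∂P - ∫ ω, w (k + 1) ω ∂P + c k := fun k => by
    have := hstep k Set.univ MeasurableSet.univ
    simp only [setIntegral_univ, probReal_univ] at this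
    linarith
  -- Telescoping the expectations uses the discarded term. If the limit had positive mean, `∫ w k`
  -- would eventually exceed half of it, forcing `θ` to be summable.
  have hsum : Summable fun k => θ k * ∫ ω, w k ω ∂P := by
    refine summable_of_sum_range_le (c := ∫ ω, w 0 ω ∂P + ∑' j, c j)
      (fun k => mul_nonneg (hθ k) (hE0 k)) fun N => ?_
    refine (Finset.sum_le_sum fun k _ => hrec k).trans ?_
    rw [Finset.sum_add_distrib, Finset.sum_range_sub']
    linarith [hE0 N, hSle N]
  have hz : ∫ ω, g ω ∂P = 0 := by
    by_contra hne
    have hpos : 0 < ∫ ω, g ω ∂P := lt_of_le_of_ne (integral_nonneg_of_ae hg0) (Ne.symm hne)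
    refine hθsum ((summable_of_isBigO_nat hsum) ?_)
    refine Asymptotics.IsBigO.of_bound (2 / ∫ ω, g ω ∂P) ?_
    filter_upwards [hEg.eventually_const_le (half_lt_self hpos)] with k hk
    rw [Real.norm_of_nonneg (hθ k), Real.norm_of_nonneg (mul_nonneg (hθ k) (hE0 k)),
      div_mul_eq_mul_div, le_div_iff₀ hpos]
    nlinarith [hθ k]
  have hgz := (integral_eq_zero_iff_of_nonneg_ae hg0 hgi).1 hz
  filter_upwards [hg, hgz] with ω h1 h2
  rwa [h2] at h1

/-! ### The scheme: adaptedness, independence from the past, one-step estimate. -/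

/-- One step of the scheme, as a function of the current point and of the random inputs. -/
noncomputable def rssaStep {n d : ℕ} (X : Set (RSpace n)) (Φ : RSpace n → RSpace d → RSpace n)
    (γ η : ℝ) (p : RSpace n × (RSpace n × RSpace d)) : RSpace n :=
  euclProj X (p.1 - γ • (Φ (p.1 + p.2.1) p.2.2 + η • p.1))

/-- The random inputs used in the first `k` steps. -/
def rssaPast {n d : ℕ} {Ω : Type*} (x0 : Ω → RSpace n) (ξs : ℕ → Ω → RSpace d)
    (z : ℕ → Ω → RSpace n) (k : ℕ) (ω : Ω) : RSpace n × (ℕ → RSpace d) × (ℕ → RSpace n) :=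
  (x0 ω, fun j => if j < k then ξs j ω else 0, fun j => if j < k then z j ω else 0)

theorem measurable_initialSegment {α : Type*} [MeasurableSpace α] [Zero α] (k : ℕ) :
    Measurable fun (u : ℕ → α) (j : ℕ) => if j < k then u j else 0 := by
  refine measurable_pi_lambda _ fun j => ?_
  by_cases hj : j < k
  · simpa only [hj, if_true] using measurable_pi_apply j
  · simp only [hj, if_false]; exact measurable_const

section Scheme

variable {n d : ℕ} {Ω : Type*} [mΩ : MeasurableSpace Ω] {P : Measure Ω}
  {X : Set (RSpace n)} {Φ : RSpace n → RSpace d → RSpace n} {ξ : Ω → RSpace d} {ε C : ℝ}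
  {γ η εs : ℕ → ℝ} {x0 : Ω → RSpace n} {ξs : ℕ → Ω → RSpace d} {z : ℕ → Ω → RSpace n}

theorem ProblemAssumption.nonempty (h : ProblemAssumption P X Φ ξ ε C) : X.Nonempty :=
  h.solvable.imp fun _ hx => hx.1

theorem ProblemAssumption.measurable_rssaStep (h : ProblemAssumption P X Φ ξ ε C) (a b : ℝ) :
    Measurable (rssaStep X Φ a b) := by
  have h1 : Measurable fun p : RSpace n × (RSpace n × RSpace d) => Φ (p.1 + p.2.1) p.2.2 :=
    h.measurable_Φ.comp (f := fun p : RSpace n × (RSpace n × RSpace d) => (p.1 + p.2.1, p.2.2))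
      (by fun_prop)
  refine (continuous_euclProj h.nonempty h.closed h.convex).measurable.comp ?_
  exact measurable_fst.sub ((h1.add (measurable_fst.const_smul b)).const_smul a)

theorem ProblemAssumption.measurable_rssaStep_comp (h : ProblemAssumption P X Φ ξ ε C) (a b : ℝ)
    {Ω' : Type*} {m : MeasurableSpace Ω'} {f g : Ω' → RSpace n} {e : Ω' → RSpace d}
    (hf : Measurable f) (hg : Measurable g) (he : Measurable e) :
    Measurable fun ω => rssaStep X Φ a b (f ω, (g ω, e ω)) :=
  (h.measurable_rssaStep a b).comp (hf.prodMk (hg.prodMk he))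

section Assumptions

variable (h : ProblemAssumption P X Φ ξ ε C) (hrand : RandomInputAssumption P X ξ εs x0 ξs z)

include h hrand in
theorem rssa_mem (k : ℕ) (ω : Ω) : rssa X Φ γ η x0 ξs z k ω ∈ X := by
  cases k with
  | zero => exact hrand.x0_mem ω
  | succ k => exact euclProj_mem h.nonempty h.closed h.convex _

include hrand in
theorem measurable_rssaPast (k : ℕ) : Measurable (rssaPast x0 ξs z k) := by
  exact hrand.measurable_x0.prodMk
    (((measurable_initialSegment k).comp (measurable_pi_lambda _ hrand.measurable_ξs)).prodMk
      ((measurable_initialSegment k).comp (measurable_pi_lambda _ hrand.measurable_z)))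

omit mΩ in
theorem comap_rssaPast_mono {j k : ℕ} (hjk : j ≤ k) :
    MeasurableSpace.comap (rssaPast x0 ξs z j) inferInstance ≤
      MeasurableSpace.comap (rssaPast x0 ξs z k) inferInstance := by
  have hT : Measurable fun q : RSpace n × (ℕ → RSpace d) × (ℕ → RSpace n) =>
      ((q.1, fun i => if i < j then q.2.1 i else 0, fun i => if i < j then q.2.2 i else 0) :
        RSpace n × (ℕ → RSpace d) × (ℕ → RSpace n)) := by
    exact measurable_fst.prodMk
      (((measurable_initialSegment j).comp measurable_snd.fst).prodMk
        ((measurable_initialSegment j).comp measurable_snd.snd))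
  refine measurable_iff_comap_le.1 ?_
  have e : rssaPast x0 ξs z j = (fun q : RSpace n × (ℕ → RSpace d) × (ℕ → RSpace n) =>
      ((q.1, fun i => if i < j then q.2.1 i else 0, fun i => if i < j then q.2.2 i else 0) :
        RSpace n × (ℕ → RSpace d) × (ℕ → RSpace n))) ∘ rssaPast x0 ξs z k := by
    funext ω
    simp only [rssaPast, Function.comp]
    refine Prod.ext rfl (Prod.ext ?_ ?_) <;> funext i <;> by_cases hi : i < j <;>
      simp only [hi, if_true, if_false] <;> rw [if_pos (hi.trans_le hjk)]
  rw [e]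
  exact hT.comp (comap_measurable _)

/-- The filtration of the random inputs: at time `k` the inputs of the first `k + 1` steps are
known. -/
def rssaFiltration (hrand : RandomInputAssumption P X ξ εs x0 ξs z) : Filtration ℕ mΩ where
  -- The shift makes `x_{k+1} - s_k`, the process to be studied, adapted.
  seq k := MeasurableSpace.comap (rssaPast x0 ξs z (k + 1)) inferInstance
  mono' _ _ hjk := comap_rssaPast_mono (Nat.succ_le_succ hjk)
  le' k := (measurable_rssaPast hrand (k + 1)).comap_le

include h in
theorem measurable_comap_rssa (k : ℕ) :
    Measurable[MeasurableSpace.comap (rssaPast x0 ξs z k) inferInstance]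
      (rssa X Φ γ η x0 ξs z k) := by
  induction k with
  | zero => exact measurable_fst.comp (comap_measurable (rssaPast x0 ξs z 0))
  | succ k ih =>
    have hx := ih.mono (comap_rssaPast_mono k.le_succ) le_rfl
    have hp := comap_measurable (m := inferInstance) (rssaPast x0 ξs z (k + 1))
    have hξ : Measurable[MeasurableSpace.comap (rssaPast x0 ξs z (k + 1)) inferInstance]
        (ξs k) := by
      have h1 := (((measurable_pi_apply k).comp measurable_fst).comp measurable_snd).comp hp
      convert h1 using 1
      funext ω
      simp [rssaPast]
    have hz : Measurable[MeasurableSpace.comap (rssaPast x0 ξs z (k + 1)) inferInstance]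
        (z k) := by
      have h1 := (((measurable_pi_apply k).comp measurable_snd).comp measurable_snd).comp hp
      convert h1 using 1
      funext ω
      simp [rssaPast]
    exact h.measurable_rssaStep_comp (γ k) (η k) hx hz hξ

include hrand in
theorem indepFun_perturbation_sample (k : ℕ) : IndepFun (z k) (ξs k) P :=
  (hrand.indep_ξs_z.comp (measurable_pi_apply k) (measurable_pi_apply k)).symm

include hrand in
theorem indepFun_rssaPast [IsProbabilityMeasure P] (k : ℕ) :
    IndepFun (rssaPast x0 ξs z k) (fun ω => (z k ω, ξs k ω)) P := by
  have hp := measurable_rssaPast hrand k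
  have mx : Measurable fun ω => fun j => if j < k then ξs j ω else 0 :=
    (measurable_fst.comp measurable_snd).comp hp
  have mz : Measurable fun ω => fun j => if j < k then z j ω else 0 :=
    (measurable_snd.comp measurable_snd).comp hp
  have hseg : ∀ m : ℕ, Measurable fun (u : ℕ → RSpace m) =>
      ((fun j => if j < k then u j else 0, u k) : (ℕ → RSpace m) × RSpace m) := fun m => by
    exact (measurable_initialSegment k).prodMk (measurable_pi_apply k)
  have h1 := indepFun_prodMk_transpose mx (hrand.measurable_ξs k) mz (hrand.measurable_z k)
    (indepFun_initialSegment hrand.indep_ξs hrand.measurable_ξs k)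
    (indepFun_initialSegment hrand.indep_z hrand.measurable_z k)
    (hrand.indep_ξs_z.comp (hseg d) (hseg n))
  -- The trivial variable `()` fills the fourth slot, so that `x0` joins the past by a second
  -- transposition.
  have h2 : IndepFun (fun ω => (x0 ω, ())) (fun ω =>
      (((fun j => if j < k then ξs j ω else 0, fun j => if j < k then z j ω else 0) :
        (ℕ → RSpace d) × (ℕ → RSpace n)), ((ξs k ω, z k ω) : RSpace d × RSpace n))) P := by
    have hT : Measurable fun q : (ℕ → RSpace d) × (ℕ → RSpace n) =>
        (((fun j => if j < k then q.1 j else 0, fun j => if j < k then q.2 j else 0) :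
          (ℕ → RSpace d) × (ℕ → RSpace n)), ((q.1 k, q.2 k) : RSpace d × RSpace n)) := by
      exact (((measurable_initialSegment k).comp measurable_fst).prodMk
        ((measurable_initialSegment k).comp measurable_snd)).prodMk
        (((measurable_pi_apply k).comp measurable_fst).prodMk
          ((measurable_pi_apply k).comp measurable_snd))
    exact hrand.indep_x0.comp (measurable_id.prodMk measurable_const) hT
  have h3 := indepFun_prodMk_transpose hrand.measurable_x0 (measurable_const (a := ()))
    (mx.prodMk mz) ((hrand.measurable_ξs k).prodMk (hrand.measurable_z k))
    (indepFun_const_right _ _) h1 h2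
  exact h3.comp measurable_id (measurable_snd.snd.prodMk measurable_snd.fst)

end Assumptions

section Moments

variable [IsProbabilityMeasure P]
  (h : ProblemAssumption P X Φ ξ ε C) (hrand : RandomInputAssumption P X ξ εs x0 ξs z)
  (htune : TuningAssumption n ε C γ η εs) {x : RSpace n} (hx : x ∈ X) (k : ℕ)

include h hrand htune hx

/-- With `z k` frozen, `x + z k` almost surely lies in the enlargement, where the moment bound
holds; independence of `z k` and `ξs k` permits the freezing. -/
theorem ProblemAssumption.second_moment_sample :
    Integrable (fun ω => ‖Φ (x + z k ω) (ξs k ω)‖ ^ 2) P ∧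
      ∫ ω, ‖Φ (x + z k ω) (ξs k ω)‖ ^ 2 ∂P ≤ C ^ 2 := by
  have hind := indepFun_perturbation_sample hrand k
  have hg : Measurable fun p : RSpace n × RSpace d => ‖Φ (x + p.1) p.2‖ ^ 2 := by
    have h1 : Measurable fun p : RSpace n × RSpace d => Φ (x + p.1) p.2 :=
      h.measurable_Φ.comp (f := fun p : RSpace n × RSpace d => (x + p.1, p.2)) (by fun_prop)
    exact h1.norm.pow_const 2
  have hsec : ∀ᵐ ω ∂P, Integrable (fun ω' => ‖Φ (x + z k ω) (ξs k ω')‖ ^ 2) P ∧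
      ∫ ω', ‖Φ (x + z k ω) (ξs k ω')‖ ^ 2 ∂P ≤ C ^ 2 := by
    filter_upwards [ae_mem_closedBall_of_isUniform (htune.εs_pos k) (hrand.measurable_z k)
      (hrand.uniform_z k)] with ω hω
    have hu : Measurable fun y => ‖Φ (x + z k ω) y‖ ^ 2 :=
      (h.measurable_Φ.comp measurable_prodMk_left).norm.pow_const 2
    have hid := (hrand.identDistrib_ξs k).comp hu
    obtain ⟨h1, h2⟩ := h.second_moment _ (add_mem_enlargement hx hω (htune.cond_c k))
    exact ⟨hid.integrable_iff.2 h1, hid.integral_eq.trans_le h2⟩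
  have hint := integrable_comp_of_indepFun (hrand.measurable_z k) (hrand.measurable_ξs k) hind
    hg.stronglyMeasurable (K := C ^ 2) (by
      filter_upwards [hsec] with ω hω
      simpa using hω)
  refine ⟨hint, ?_⟩
  rw [integral_comp_eq_of_indepFun (hrand.measurable_z k) (hrand.measurable_ξs k) hind
    hg.stronglyMeasurable hint]
  refine (integral_mono_of_nonneg (g := fun _ => C ^ 2)
    (ae_of_all _ fun ω => integral_nonneg fun _ => sq_nonneg _) (integrable_const _) ?_).trans
    (by simp)
  filter_upwards [hsec] with ω hω using hω.2

theorem ProblemAssumption.integral_sample :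
    Integrable (fun ω => Φ (x + z k ω) (ξs k ω)) P ∧
      ∫ ω, Φ (x + z k ω) (ξs k ω) ∂P = smoothedMap P (meanMap P Φ ξ) (z k) x := by
  have h1 : Measurable fun p : RSpace n × RSpace d => Φ (x + p.1) p.2 :=
    h.measurable_Φ.comp (f := fun p : RSpace n × RSpace d => (x + p.1, p.2)) (by fun_prop)
  have hint : Integrable (fun ω => Φ (x + z k ω) (ξs k ω)) P :=
    ((memLp_two_iff_integrable_sq_norm (h1.comp ((hrand.measurable_z k).prodMk
      (hrand.measurable_ξs k))).aestronglyMeasurable).2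
      (h.second_moment_sample hrand htune hx k).1).integrable one_le_two
  refine ⟨hint, ?_⟩
  rw [integral_comp_eq_of_indepFun (hrand.measurable_z k) (hrand.measurable_ξs k)
    (indepFun_perturbation_sample hrand k) h1.stronglyMeasurable hint]
  refine integral_congr_ae (ae_of_all _ fun ω => ?_)
  have hu : Measurable fun y => Φ (x + z k ω) y := h.measurable_Φ.comp measurable_prodMk_left
  exact ((hrand.identDistrib_ξs k).comp hu).integral_eq

/-- The expected squared distance to the regularized solution after one step from `x`. -/
theorem ProblemAssumption.integral_norm_rssaStep_sub_sq_le {M : ℝ} (hM : ∀ x ∈ X, ‖x‖ ≤ M)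
    {s : RSpace n}
    (hs : IsVISol X (regularizedMap (smoothedMap P (meanMap P Φ ξ) (z k)) (η k)) s) :
    ∫ ω, ‖rssaStep X Φ (γ k) (η k) (x, (z k ω, ξs k ω)) - s‖ ^ 2 ∂P ≤
      (1 - 2 * (γ k * η k)) * ‖x - s‖ ^ 2 + γ k ^ 2 * (2 * C ^ 2 + 2 * (η k * M) ^ 2) := by
  obtain ⟨hi2, hC2⟩ := h.second_moment_sample hrand htune hx k
  obtain ⟨hi1, hmean⟩ := h.integral_sample hrand htune hx k
  have hγ := htune.γ_pos k
  have hη := htune.η_pos k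
  have hpt : ∀ ω, ‖rssaStep X Φ (γ k) (η k) (x, (z k ω, ξs k ω)) - s‖ ^ 2 ≤
      ‖x - s‖ ^ 2 - 2 * γ k * inner ℝ (x - s) (Φ (x + z k ω) (ξs k ω) + η k • x) +
        γ k ^ 2 * (2 * ‖Φ (x + z k ω) (ξs k ω)‖ ^ 2 + 2 * (η k * M) ^ 2) := by
    intro ω
    have h1 := norm_euclProj_sub_le h.nonempty h.closed h.convex
      (x - γ k • (Φ (x + z k ω) (ξs k ω) + η k • x)) s
    rw [euclProj_eq_self h.nonempty h.closed h.convex hs.1] at h1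
    have h2 : ‖rssaStep X Φ (γ k) (η k) (x, (z k ω, ξs k ω)) - s‖ ^ 2 ≤
      ‖x - γ k • (Φ (x + z k ω) (ξs k ω) + η k • x) - s‖ ^ 2 := by
      unfold rssaStep; gcongr
    refine h2.trans ?_
    rw [sub_right_comm, norm_sub_sq_real, real_inner_smul_right, norm_smul,
      Real.norm_of_nonneg hγ.le, mul_pow, ← mul_assoc]
    gcongr
    have h3 : ‖Φ (x + z k ω) (ξs k ω) + η k • x‖ ≤ ‖Φ (x + z k ω) (ξs k ω)‖ + η k * M := by
      refine (norm_add_le _ _).trans ?_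
      rw [norm_smul, Real.norm_of_nonneg hη.le]
      gcongr
      exact hM x hx
    nlinarith [norm_nonneg (Φ (x + z k ω) (ξs k ω) + η k • x),
      sq_nonneg (‖Φ (x + z k ω) (ξs k ω)‖ - η k * M)]
  have hiadd : Integrable (fun ω => Φ (x + z k ω) (ξs k ω) + η k • x) P :=
    hi1.add (integrable_const _)
  have hA : Integrable (fun ω => ‖x - s‖ ^ 2 -
      2 * γ k * inner ℝ (x - s) (Φ (x + z k ω) (ξs k ω) + η k • x)) P :=
    (integrable_const _).sub ((hiadd.const_inner _).const_mul _)
  have hB : Integrable (fun ω =>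
      γ k ^ 2 * (2 * ‖Φ (x + z k ω) (ξs k ω)‖ ^ 2 + 2 * (η k * M) ^ 2)) P :=
    ((hi2.const_mul 2).add (integrable_const _)).const_mul _
  refine (integral_mono_of_nonneg (ae_of_all _ fun ω => sq_nonneg _) (hA.add hB)
    (ae_of_all _ hpt)).trans ?_
  simp only [Pi.add_apply]
  rw [integral_add hA hB, integral_sub (integrable_const _) ((hiadd.const_inner _).const_mul _),
    integral_const_mul, integral_const_mul, integral_add (hi2.const_mul 2) (integrable_const _),
    integral_const_mul, integral_inner hiadd, integral_add hi1 (integrable_const _), hmean]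
  simp only [integral_const, probReal_univ, one_smul]
  have hsm := h.regularizedMap_stronglyMonotone (htune.εs_pos k) (htune.cond_c k)
    (hrand.measurable_z k) (hrand.uniform_z k) (η k) hx hs.1
  have hvi := hs.2 x hx
  rw [inner_sub_left] at hsm
  -- Strong monotonicity together with the inequality at `s` tested at `x`: the source of the factor
  -- `1 - 2 γ η`.
  have h4 : η k * ‖x - s‖ ^ 2 ≤
      inner ℝ (x - s) (smoothedMap P (meanMap P Φ ξ) (z k) x + η k • x) := by
    rw [real_inner_comm]
    change _ ≤ inner ℝ (regularizedMap (smoothedMap P (meanMap P Φ ξ) (z k)) (η k) x) (x - s)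
    linarith
  have h5 := mul_le_mul_of_nonneg_left h4 (by positivity : 0 ≤ 2 * γ k)
  have h6 : γ k ^ 2 * (2 * ∫ ω, ‖Φ (x + z k ω) (ξs k ω)‖ ^ 2 ∂P + 2 * (η k * M) ^ 2) ≤
      γ k ^ 2 * (2 * C ^ 2 + 2 * (η k * M) ^ 2) := by gcongr
  linarith

end Moments

end Scheme

/-- Young's inequality `(q + Δ)² ≤ (1 + θ)(q² + Δ² / θ)` with `(1 - 2θ)(1 + θ) ≤ 1 - θ`. For `2θ >
1` the left side is nonpositive and no contraction is claimed. -/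
theorem one_sub_two_mul_sq_le {θ p q Δ : ℝ} (hθ : 0 < θ) (hp : 0 ≤ p)
    (hpq : p ≤ q + Δ) :
    (1 - 2 * θ) * p ^ 2 ≤ (1 - if 2 * θ ≤ 1 then θ else 0) * q ^ 2 + Δ ^ 2 / θ := by
  split_ifs with h
  · have h1 : p ^ 2 ≤ (q + Δ) ^ 2 := by gcongr
    have h2 : θ * (q + Δ) ^ 2 ≤ (1 + θ) * (θ * q ^ 2 + Δ ^ 2) := by
      nlinarith [sq_nonneg (θ * q - Δ)]
    have h3 : 0 ≤ θ * q ^ 2 + Δ ^ 2 := by positivity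
    have h4 : θ * ((1 - 2 * θ) * p ^ 2) ≤ θ * ((1 - θ) * q ^ 2) + Δ ^ 2 := by
      calc θ * ((1 - 2 * θ) * p ^ 2) = (1 - 2 * θ) * (θ * p ^ 2) := by ring
        _ ≤ (1 - 2 * θ) * ((1 + θ) * (θ * q ^ 2 + Δ ^ 2)) := by
            refine mul_le_mul_of_nonneg_left (le_trans ?_ h2) (by linarith)
            gcongr
        _ = (1 - θ - 2 * θ ^ 2) * (θ * q ^ 2 + Δ ^ 2) := by ring
        _ ≤ (1 - θ) * (θ * q ^ 2 + Δ ^ 2) := by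
            refine mul_le_mul_of_nonneg_right ?_ h3
            linarith [sq_nonneg θ]
        _ ≤ θ * ((1 - θ) * q ^ 2) + Δ ^ 2 := by nlinarith [mul_nonneg hθ.le (sq_nonneg Δ)]
    have h5 : (1 - 2 * θ) * p ^ 2 - (1 - θ) * q ^ 2 ≤ Δ ^ 2 / θ := by
      rw [le_div_iff₀ hθ]; linarith
    linarith
  · have h1 : (1 - 2 * θ) * p ^ 2 ≤ 0 :=
      mul_nonpos_of_nonpos_of_nonneg (by linarith) (sq_nonneg p)
    have h2 : 0 ≤ Δ ^ 2 / θ := by positivity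
    nlinarith [sq_nonneg q]

theorem measurable_norm_sub_sq {n : ℕ} {α : Type*} {m : MeasurableSpace α} {f : α → RSpace n}
    (hf : Measurable f) (c : RSpace n) : Measurable fun a => ‖f a - c‖ ^ 2 :=
  (hf.sub_const c).norm.pow_const 2

/-! ### Drift of the targets and almost sure convergence. -/

section Convergence

variable {n d : ℕ} {Ω : Type*} [mΩ : MeasurableSpace Ω] {P : Measure Ω}
  {X : Set (RSpace n)} {Φ : RSpace n → RSpace d → RSpace n} {ξ : Ω → RSpace d} {ε C : ℝ}
  {γ η εs : ℕ → ℝ} {x0 : Ω → RSpace n} {ξs : ℕ → Ω → RSpace d} {z : ℕ → Ω → RSpace n}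

/-- The bound on the drift of the regularized solutions. -/
noncomputable def driftBound (n : ℕ) (C M : ℝ) (η εs : ℕ → ℝ) (k : ℕ) : ℝ :=
  2 * C * n * smoothingGap εs k / η k + M * |1 - η (k + 1) / η k|

/-- As `γ η → 0`, the cut-off discards only finitely many terms of the divergent series. -/
theorem TuningAssumption.not_summable (htune : TuningAssumption n ε C γ η εs) :
    ¬ Summable fun k => if 2 * (γ (k + 1) * η (k + 1)) ≤ 1 then γ (k + 1) * η (k + 1) else 0 := by
  have hlim : Tendsto (fun k => 2 * (γ (k + 1) * η (k + 1))) atTop (𝓝 0) := by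
    have h := ((htune.γ_lim.mul htune.η_lim).const_mul 2).comp (tendsto_add_atTop_nat 1)
    simpa [Function.comp_def] using h
  intro hs
  have h1 : Summable fun k => γ (k + 1) * η (k + 1) := by
    refine summable_of_isBigO_nat hs (Filter.EventuallyEq.isBigO ?_)
    filter_upwards [hlim.eventually_le_const one_pos] with k hk
    rw [if_pos hk]
  have h2 := (summable_nat_add_iff (f := fun k => γ k * η k) 1).1 h1
  exact (not_summable_iff_tendsto_nat_atTop_of_nonneg fun k =>
    (mul_pos (htune.γ_pos k) (htune.η_pos k)).le).2 htune.cond_d h2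

theorem TuningAssumption.summable_driftBound (htune : TuningAssumption n ε C γ η εs) (M : ℝ) :
    Summable fun k => driftBound n C M η εs k ^ 2 / (γ (k + 1) * η (k + 1)) := by
  refine Summable.of_nonneg_of_le (fun k => ?_) (fun k => ?_)
    ((htune.cond_f.mul_left (2 * (2 * C * n) ^ 2)).add (htune.cond_g.mul_left (2 * M ^ 2)))
  · have := htune.γ_pos (k + 1)
    have := htune.η_pos (k + 1)
    positivity
  · have h1 := htune.γ_pos (k + 1)
    have h2 := htune.η_pos (k + 1)
    have h3 := htune.η_pos k
    calc driftBound n C M η εs k ^ 2 / (γ (k + 1) * η (k + 1))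
        ≤ (2 * (2 * C * n * smoothingGap εs k / η k) ^ 2 + 2 * (M * |1 - η (k + 1) / η k|) ^ 2)
          / (γ (k + 1) * η (k + 1)) := by
          refine div_le_div_of_nonneg_right ?_ (by positivity)
          unfold driftBound
          linarith [sq_nonneg (2 * C * n * smoothingGap εs k / η k - M * |1 - η (k + 1) / η k|)]
      _ = _ := by
          rw [mul_pow M, sq_abs]
          field_simp

variable [IsProbabilityMeasure P]
  (h : ProblemAssumption P X Φ ξ ε C) (hrand : RandomInputAssumption P X ξ εs x0 ξs z)
  (htune : TuningAssumption n ε C γ η εs) {s : ℕ → RSpace n}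
  (hs : ∀ k, IsVISol X (regularizedMap (smoothedMap P (meanMap P Φ ξ) (z k)) (η k)) (s k))

include h hrand htune hs

theorem norm_regularized_succ_sub_le {M : ℝ} (hM : ∀ x ∈ X, ‖x‖ ≤ M) (k : ℕ) :
    ‖s (k + 1) - s k‖ ≤ driftBound n C M η εs k :=
  norm_isVISol_sub_le (htune.η_pos k)
    (fun _ hx _ hy => h.smoothedMap_monotone (htune.εs_pos k) (htune.cond_c k)
      (hrand.measurable_z k) (hrand.uniform_z k) hx hy)
    (fun _ hx => h.norm_smoothedMap_sub_smoothedMap_le (htune.εs_pos k) (htune.cond_c k)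
      (hrand.measurable_z k) (hrand.uniform_z k) (htune.εs_pos (k + 1)) (htune.cond_c (k + 1))
      (hrand.measurable_z (k + 1)) (hrand.uniform_z (k + 1)) hx) hM (hs k) (hs (k + 1))

theorem setIntegral_norm_rssa_sub_sq_le {M : ℝ} (hM : ∀ x ∈ X, ‖x‖ ≤ M) (k : ℕ) {A : Set Ω}
    (hA : MeasurableSet[MeasurableSpace.comap (rssaPast x0 ξs z k) inferInstance] A) :
    ∫ ω in A, ‖rssa X Φ γ η x0 ξs z (k + 1) ω - s k‖ ^ 2 ∂P ≤
      ∫ ω in A, ((1 - 2 * (γ k * η k)) * ‖rssa X Φ γ η x0 ξs z k ω - s k‖ ^ 2 +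
        γ k ^ 2 * (2 * C ^ 2 + 2 * (η k * M) ^ 2)) ∂P := by
  have hm : MeasurableSpace.comap (rssaPast x0 ξs z k) inferInstance ≤ mΩ :=
    (measurable_rssaPast hrand k).comap_le
  have hU := measurable_comap_rssa (γ := γ) (η := η) (x0 := x0) (ξs := ξs) (z := z) h k
  have hU' := hU.mono hm le_rfl
  have hdiam : ∀ x ∈ X, ‖x - s k‖ ^ 2 ≤ (M + M) ^ 2 := fun x hx => by
    have := (norm_sub_le x (s k)).trans (add_le_add (hM x hx) (hM _ (hs k).1))
    gcongr
  have hψ : Integrable (fun ω => ‖rssa X Φ γ η x0 ξs z k ω - s k‖ ^ 2) P :=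
    Integrable.of_bound (C := (M + M) ^ 2)
      (measurable_norm_sub_sq hU' _).aestronglyMeasurable (ae_of_all _ fun ω => by
        rw [Real.norm_of_nonneg (sq_nonneg _)]
        exact hdiam _ (rssa_mem h hrand k ω))
  have hg : Measurable fun p : RSpace n × (RSpace n × RSpace d) =>
      ‖rssaStep X Φ (γ k) (η k) p - s k‖ ^ 2 :=
    measurable_norm_sub_sq (h.measurable_rssaStep (γ k) (η k)) _
  exact setIntegral_comp_le_of_indep (V := fun ω => (z k ω, ξs k ω)) (B := (M + M) ^ 2)
    (ψ := fun x => (1 - 2 * (γ k * η k)) * ‖x - s k‖ ^ 2 +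
        γ k ^ 2 * (2 * C ^ 2 + 2 * (η k * M) ^ 2)) hm hU
    ((hrand.measurable_z k).prodMk (hrand.measurable_ξs k))
    ((IndepFun_iff_Indep _ _ _).1 (indepFun_rssaPast hrand k)) hg
    (fun ω ω' => by
      rw [Real.norm_of_nonneg (sq_nonneg _)]
      exact hdiam _ (euclProj_mem h.nonempty h.closed h.convex _))
    ((hψ.const_mul _).add (integrable_const _))
    (fun ω => h.integral_norm_rssaStep_sub_sq_le hrand htune (rssa_mem h hrand k ω) k hM (hs k))
    hA

theorem ae_tendsto_norm_rssa_sub :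
    ∀ᵐ ω ∂P, Tendsto (fun k => ‖rssa X Φ γ η x0 ξs z (k + 1) ω - s k‖) atTop (𝓝 0) := by
  obtain ⟨M, hM⟩ := h.bounded.exists_norm_le
  -- A uniform bound on `η` makes the one-step error a constant multiple of `γ²`, hence summable.
  obtain ⟨H, hH⟩ := htune.η_lim.bddAbove_range
  have hHk : ∀ k, η k ≤ H := fun k => hH ⟨k, rfl⟩
  have hM0 : 0 ≤ M := (norm_nonneg _).trans (hM _ (hs 0).1)
  have hmeas : ∀ k, Measurable[rssaFiltration hrand k]
      fun ω => ‖rssa X Φ γ η x0 ξs z (k + 1) ω - s k‖ ^ 2 := fun k =>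
    measurable_norm_sub_sq (measurable_comap_rssa h (k + 1)) _
  have hdiam : ∀ k j ω, ‖rssa X Φ γ η x0 ξs z k ω - s j‖ ^ 2 ≤ (M + M) ^ 2 := fun k j ω => by
    have := (norm_sub_le (rssa X Φ γ η x0 ξs z k ω) (s j)).trans
      (add_le_add (hM _ (rssa_mem h hrand k ω)) (hM _ (hs j).1))
    gcongr
  have hint : ∀ k j, Integrable (fun ω => ‖rssa X Φ γ η x0 ξs z k ω - s j‖ ^ 2) P := fun k j =>
    Integrable.of_bound (C := (M + M) ^ 2)
      (measurable_norm_sub_sq ((measurable_comap_rssa h k).mono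
        (measurable_rssaPast hrand k).comap_le le_rfl) _).aestronglyMeasurable (ae_of_all _ fun ω => by
        rw [Real.norm_of_nonneg (sq_nonneg _)]
        exact hdiam k j ω)
  have key := ae_tendsto_zero_of_setIntegral_le (P := P) (𝒢 := rssaFiltration hrand)
    (w := fun k ω => ‖rssa X Φ γ η x0 ξs z (k + 1) ω - s k‖ ^ 2)
    (θ := fun k => if 2 * (γ (k + 1) * η (k + 1)) ≤ 1 then γ (k + 1) * η (k + 1) else 0)
    (c := fun k => driftBound n C M η εs k ^ 2 / (γ (k + 1) * η (k + 1)) +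
      γ (k + 1) ^ 2 * (2 * C ^ 2 + 2 * (H * M) ^ 2)) (B := (M + M) ^ 2) hmeas
    (fun k ω => sq_nonneg _) (fun k ω => hdiam _ _ ω)
    (fun k => by
      have := (mul_pos (htune.γ_pos (k + 1)) (htune.η_pos (k + 1))).le
      split_ifs <;> simp [this])
    htune.not_summable
    (fun k => by
      have := htune.γ_pos (k + 1)
      have := htune.η_pos (k + 1)
      positivity)
    ((htune.summable_driftBound M).add
      (((summable_nat_add_iff 1).2 htune.cond_e).mul_right _))
    fun k A hA => ?_
  · filter_upwards [key] with ω hω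
    have := hω.sqrt
    simpa [Real.sqrt_sq (norm_nonneg _)] using this
  have hγ := htune.γ_pos (k + 1)
  have hη := htune.η_pos (k + 1)
  refine (setIntegral_norm_rssa_sub_sq_le h hrand htune hs hM (k + 1) hA).trans ?_
  rw [← integral_const_mul, mul_comm (_ + _) (P.real A),
    ← smul_eq_mul (P.real A), ← setIntegral_const, ← integral_add
      ((hint (k + 1) k).integrableOn.const_mul _) (integrable_const _).integrableOn]
  refine integral_mono ((((hint (k + 1) (k + 1)).const_mul _).add
    (integrable_const _)).integrableOn) ((((hint (k + 1) k).const_mul _).add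
    (integrable_const _)).integrableOn) fun ω => ?_
  -- The step from `x_{k+1}` to `x_{k+2}` contracts towards `s (k+1)`; the drift bound recenters the
  -- starting distance at `s k`.
  have hdrift := norm_regularized_succ_sub_le h hrand htune hs hM k
  have h1 := one_sub_two_mul_sq_le (mul_pos hγ hη)
    (norm_nonneg (rssa X Φ γ η x0 ξs z (k + 1) ω - s (k + 1)))
    (q := ‖rssa X Φ γ η x0 ξs z (k + 1) ω - s k‖) (Δ := driftBound n C M η εs k) (by
      refine (norm_sub_le_norm_sub_add_norm_sub _ (s k) _).trans (add_le_add le_rfl ?_)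
      rwa [norm_sub_rev])
  have h2 : γ (k + 1) ^ 2 * (2 * C ^ 2 + 2 * (η (k + 1) * M) ^ 2) ≤
      γ (k + 1) ^ 2 * (2 * C ^ 2 + 2 * (H * M) ^ 2) := by
    gcongr
    exact hHk _
  dsimp only
  linarith

omit h hrand htune hs [IsProbabilityMeasure P] mΩ in
theorem mapClusterPt_of_tendsto_norm_succ_sub {x s : ℕ → RSpace n}
    (hxs : Tendsto (fun k => ‖x (k + 1) - s k‖) atTop (𝓝 0)) {p : RSpace n}
    (hp : MapClusterPt p atTop x) : MapClusterPt p atTop s := by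
  obtain ⟨ψ, hψ, hlim⟩ := hp.tendsto_subseq
  -- `x` at `ψ (k+1)` is paired with `s` one index earlier; starting at `ψ (k+1) ≥ 1` keeps the
  -- truncated subtraction exact.
  have hψ1 : Tendsto (fun k => ψ (k + 1) - 1) atTop atTop :=
    (tendsto_sub_atTop_nat 1).comp (hψ.tendsto_atTop.comp (tendsto_add_atTop_nat 1))
  refine MapClusterPt.of_comp hψ1 (Tendsto.mapClusterPt ?_)
  have h1 := ((tendsto_add_atTop_iff_nat 1).2 hlim).sub
    ((tendsto_zero_iff_norm_tendsto_zero.2 hxs).comp hψ1)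
  rw [sub_zero] at h1
  refine h1.congr fun k => ?_
  have : 1 ≤ ψ (k + 1) := (Nat.succ_le_succ k.zero_le).trans (hψ.le_apply)
  simp [Nat.sub_add_cancel this]

end Convergence

theorem mainTheorem1 {n d : ℕ} {Ω : Type*} [MeasurableSpace Ω] (P : Measure Ω)
    [IsProbabilityMeasure P] (X : Set (RSpace n)) (Φ : RSpace n → RSpace d → RSpace n)
    (ξ : Ω → RSpace d) (ε C : ℝ) (γ η εs : ℕ → ℝ) (x0 : Ω → RSpace n)
    (ξs : ℕ → Ω → RSpace d) (z : ℕ → Ω → RSpace n)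
    (hprob : ProblemAssumption P X Φ ξ ε C)
    (hrand : RandomInputAssumption P X ξ εs x0 ξs z)
    (htune : TuningAssumption n ε C γ η εs) :
    -- the regularized smoothed problems are uniquely solvable
    (∀ k, ∃! s, IsVISol X (regularizedMap (smoothedMap P (meanMap P Φ ξ) (z k)) (η k)) s) ∧
    -- the least-norm solution exists and is unique
    (∃! t, IsLeastNormVISol X (meanMap P Φ ξ) t) ∧
    -- (a)
    (∀ s : ℕ → RSpace n,
      (∀ k, IsVISol X (regularizedMap (smoothedMap P (meanMap P Φ ξ) (z k)) (η k)) (s k)) →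
      ∀ᵐ ω ∂P,
        Tendsto (fun k => ‖rssa X Φ γ η x0 ξs z (k + 1) ω - s k‖) atTop (𝓝 0) ∧
        ∀ p, MapClusterPt p atTop (fun k => rssa X Φ γ η x0 ξs z k ω) →
          IsVISol X (meanMap P Φ ξ) p) ∧
    -- (b)
    (∀ t, IsLeastNormVISol X (meanMap P Φ ξ) t →
      Tendsto (fun k => εs k / η k) atTop (𝓝 0) →
      BoundedJacobianNear (meanMap P Φ ξ) t →
      ∀ᵐ ω ∂P, Tendsto (fun k => rssa X Φ γ η x0 ξs z k ω) atTop (𝓝 t)) := by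
  have hsol : ∀ k, ∃! s,
      IsVISol X (regularizedMap (smoothedMap P (meanMap P Φ ξ) (z k)) (η k)) s := fun k =>
    hprob.existsUnique_isVISol_regularizedMap (htune.εs_pos k) (htune.cond_c k)
      (hrand.measurable_z k) (hrand.uniform_z k) (htune.η_pos k)
  refine ⟨hsol, hprob.existsUnique_isLeastNormVISol_meanMap htune, fun s hs => ?_,
    fun t ht hrate hJ => ?_⟩
  · filter_upwards [ae_tendsto_norm_rssa_sub hprob hrand htune hs] with ω hω
    exact ⟨hω, fun p hp => hprob.isVISol_of_mapClusterPt_regularized hrand htune hs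
      (mapClusterPt_of_tendsto_norm_succ_sub
        (x := fun k => rssa X Φ γ η x0 ξs z k ω) hω hp)⟩
  · choose s hs _ using hsol
    have hst := hprob.tendsto_regularized_isLeastNormVISol hrand htune hs ht hrate hJ
    filter_upwards [ae_tendsto_norm_rssa_sub hprob hrand htune hs] with ω hω
    refine (tendsto_add_atTop_iff_nat (f := fun k => rssa X Φ γ η x0 ξs z k ω) 1).1 ?_
    have h1 := (tendsto_zero_iff_norm_tendsto_zero.2 hω).add hst
    simpa only [sub_add_cancel, zero_add] using h1
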